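/- **Model.** A network has a finite set of $N$ nodes and a set $\mathcal L$ of directed links; data of commodity $c$ are destined for node $c$. $\mathcal N_n^{(o)}$ and $\mathcal N_n^{(in)}$ are the out- and in-neighbours of $n$, and $d_{\max}$ is the maximum in-degree. Time is slotted. The channel state $S(t)$ and the energy state $h(t)=(h_n(t))_n$ take finitely many values and are independent Markov chains, both irreducible and aperiodic, with arbitrary initial distributions; $0\le h_n(t)\le h_{\max}$. In slot $t$ one chooses, from the information available then (not anticipating the chains): - admissions $R_n^{(c)}(t)\in[0,R_{\max}]$; - a power vector $P(t)\ge 0$ in a nonempty compact set $\mathcal P^{(S(t))}$ with $\sum_{b}P_{[n,b]}(t)\le E_n(t)$ (energy availability); on every $\mathcal P^{(s)}$ one has $\sum_b P_{[n,b]}\le P_{\max}$, and setting any entry to $0$ stays in $\mathcal P^{(s)}$; - harvested energy $e_n(t)\in[0,h_n(t)]$; - allocated rates $\mu^{(c)}_{[n,b]}(t)\ge0$ with $\sum_c\mu_{[n,b]}^{(c)}(t)\le\mu_{[n,b]}(S(t),P(t))$. The link rates satisfy $0\le\mu_{[n,b]}\le\mu_{\max}$; setting one entry $P_{[n,m]}$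 to $0$ lowers $\mu_{[n,m]}$ by at most $\delta P_{[n,m]}$ ($\delta>0$) and does not lower the rate of any other link. The queues start at $0$, and $$E_n(t+1)=E_n(t)-\sum_{b}P_{[n,b]}(t)+e_n(t),\qquad Q_c^{(c)}(t)=0,$$ $$Q_n^{(c)}(t+1)=\Big[Q_n^{(c)}(t)-\sum_{b\in\mathcal N_n^{(o)}}\mu^{(c)}_{[n,b]}(t)\Big]^+ +\sum_{a\in\mathcal N_n^{(in)}}\tilde\mu^{(c)}_{[a,n]}(t)+R_n^{(c)}(t)\quad(n\ne c),$$ where $\tilde\mu^{(c)}_{[n,b]}(t)\in[0,\mu^{(c)}_{[n,b]}(t)]$ is the data actually sent, $\sum_b\tilde\mu_{[n,b]}^{(c)}(t)=\min\{Q_n^{(c)}(t),\sum_b\mu_{[n,b]}^{(c)}(t)\}$. Each utility $U_n^{(c)}:[0,\infty)\to\mathbb R$ is increasing, continuously differentiable and strictly concave with $U_n^{(c)}(0)=0$; $\beta=\max_{n,c}(U_n^{(c)})'(0)$; $U_{tot}(r)=\sum_{n,c}U_n^{(c)}(r^{nc})$. Put $\overline r^{nc}(t)=\frac1t\sum_{\tau<t}\mathbb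 E[R_n^{(c)}(\tau)]$ and $\overline r^{nc}=\liminf_{t\to\infty}\overline r^{nc}(t)$. The optimal utility $U_{tot}(r^*)$ is the supremum of $U_{tot}(\overline r)$ over all such policies, possibly randomized, for which $\limsup_t\frac1t\sum_{\tau<t}\sum_{n,c}\mathbb E[Q_n^{(c)}(\tau)]<\infty$ and all $E_n(t)$ stay below some finite capacity. **ESA** with parameter $V\ge1$, $\theta_n=\delta\beta V+P_{\max}$ and $\gamma=R_{\max}+d_{\max}\mu_{\max}$: in each slot (i) $e_n(t)=h_n(t)$ if $E_n(t)<\theta_n$, else $e_n(t)=0$; (ii) $R_n^{(c)}(t)$ maximizes $VU_n^{(c)}(r)-Q_n^{(c)}(t)r$ over $0\le r\le R_{\max}$; (iii) with $W^{(c)}_{[n,b]}(t)=[Q_n^{(c)}(t)-Q_b^{(c)}(t)-\gamma]^+$ and $W_{[n,b]}(t)=\max_cW_{[n,b]}^{(c)}(t)$, $P(t)\in\mathcal P^{(S(t))}$ maximizes $\sum_n\big[\sum_b\mu_{[n,b]}(S(t),P)W_{[n,b]}(t)+(E_n(t)-\theta_n)\sum_bP_{[n,b]}\big]$ subject to energy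 availability; (iv) each link gives its full rate to one commodity attaining $W_{[n,b]}(t)$ if $W_{[n,b]}(t)>0$, and allocates nothing otherwise. Ties are broken arbitrarily. **Theorem.** Under ESA: (a) for all $t$, all nodes $n$ and all commodities $c$, on every sample path, $0\le Q_n^{(c)}(t)\le\beta V+R_{\max}$ and $0\le E_n(t)\le\theta_n+h_{\max}$; (b) there is a constant $C$, depending only on the network and the two transition matrices (not on $V$, the initial distributions or the way ties are broken), with $$\liminf_{t\to\infty}U_{tot}\big(\overline r(t)\big)\ \ge\ U_{tot}(r^*)-\frac CV ,$$ and also $U_{tot}(\overline r)\ge U_{tot}(r^*)-C/V$ whenever $\overline r$ is a limit point of the vectors $\overline r(t)$, in particular whenever these averages converge. -/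

import Mathlib

open MeasureTheory ProbabilityTheory Filter Topology

noncomputable section

/-- An energy harvesting network with node set `ι` (also the set of commodities, a commodity being
named after its destination), channel states `𝒮` and energy states `ℋ`. -/
structure EnergyNetwork (ι 𝒮 ℋ : Type*) [Fintype ι] [DecidableEq ι] where
  /-- the set of directed links `[n, m]` -/
  links : Finset (ι × ι)
  /-- `U n c` is the utility function of the commodity `c` traffic admitted at node `n` -/
  U : ι → ι → ℝ → ℝ
  Rmax : ℝ
  Pmax : ℝ
  muMax : ℝ
  δ : ℝ
  hmax : ℝ
  /-- the feasible power allocation vectors in a channel state -/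
  powerSet : 𝒮 → Set (links → ℝ)
  /-- the rate-power function: channel state, power vector, link -/
  rate : 𝒮 → (links → ℝ) → links → ℝ
  /-- harvestable energy at every node in an energy state -/
  harvest : ℋ → ι → ℝ
  Rmax_nonneg : 0 ≤ Rmax
  U_zero : ∀ n c, U n c 0 = 0
  U_mono : ∀ n c, MonotoneOn (U n c) (Set.Ici 0)
  U_contDiff : ∀ n c, ContDiffOn ℝ 1 (U n c) (Set.Ici 0)
  U_strictConcave : ∀ n c, StrictConcaveOn ℝ (Set.Ici 0) (U n c)
  powerSet_nonempty : ∀ s, (powerSet s).Nonempty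
  powerSet_compact : ∀ s, IsCompact (powerSet s)
  power_nonneg : ∀ s, ∀ P ∈ powerSet s, ∀ l, 0 ≤ P l
  power_sum_le : ∀ s, ∀ P ∈ powerSet s, ∀ n : ι, (∑ l : links with l.1.1 = n, P l) ≤ Pmax
  power_zeroing : ∀ s, ∀ P ∈ powerSet s, ∀ l, Function.update P l 0 ∈ powerSet s
  rate_nonneg : ∀ s, ∀ P ∈ powerSet s, ∀ l, 0 ≤ rate s P l
  rate_le : ∀ s, ∀ P ∈ powerSet s, ∀ l, rate s P l ≤ muMax
  δ_pos : 0 < δ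
  /-- the rate of a link is at most linear in its power -/
  rate_linear : ∀ s, ∀ P ∈ powerSet s, ∀ l,
    rate s P l ≤ rate s (Function.update P l 0) l + δ * P l
  /-- switching a link off does not reduce the rate of any other link -/
  rate_interference : ∀ s, ∀ P ∈ powerSet s, ∀ l l', l' ≠ l →
    rate s P l' ≤ rate s (Function.update P l 0) l'
  harvest_nonneg : ∀ j n, 0 ≤ harvest j n
  harvest_le : ∀ j n, harvest j n ≤ hmax

/-- A transition matrix of an irreducible aperiodic Markov chain on a finite state space. -/
structure IsIrreducibleAperiodic {S : Type*} [Fintype S] [DecidableEq S] (K : Matrix S S ℝ) :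
    Prop where
  stochastic : K ∈ Matrix.rowStochastic ℝ S
  irreducible : K.IsIrreducible
  /-- the return times of every state have greatest common divisor `1` -/
  aperiodic : ∀ s, ∀ d : ℕ, (∀ k : ℕ, 0 < k → 0 < (K ^ k) s s → d ∣ k) → d = 1

/-- `S` and `H` are independent Markov chains with transition matrices `KS`, `KH` and initial
distributions `αS`, `αH`, and `ℱ` (the information available in each slot) does not anticipate
them: given `ℱ t`, the next pair of states has its Markovian transition law. -/
structure IsMarkovPair {𝒮 ℋ Ω : Type*} {m : MeasurableSpace Ω} (Pr : Measure Ω)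
    (ℱ : Filtration ℕ m) (KS : Matrix 𝒮 𝒮 ℝ) (KH : Matrix ℋ ℋ ℝ) (αS : 𝒮 → ℝ) (αH : ℋ → ℝ)
    (S : ℕ → Ω → 𝒮) (H : ℕ → Ω → ℋ) : Prop where
  measurable_S : ∀ t s, MeasurableSet[ℱ t] {ω | S t ω = s}
  measurable_H : ∀ t j, MeasurableSet[ℱ t] {ω | H t ω = j}
  init : ∀ s j, Pr.real {ω | S 0 ω = s ∧ H 0 ω = j} = αS s * αH j
  step : ∀ t s j,
    Pr[Set.indicator {ω | S (t + 1) ω = s ∧ H (t + 1) ω = j} (fun _ => (1 : ℝ)) | ℱ t]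
      =ᵐ[Pr] fun ω => KS (S t ω) s * KH (H t ω) j

namespace EnergyNetwork

variable {ι 𝒮 ℋ : Type*} [Fintype ι] [DecidableEq ι] (N : EnergyNetwork ι 𝒮 ℋ)

/-- Sum over the outgoing links of node `n`. -/
def outSum (x : N.links → ℝ) (n : ι) : ℝ := ∑ l : N.links with l.1.1 = n, x l

/-- Sum over the incoming links of node `n`. -/
def inSum (x : N.links → ℝ) (n : ι) : ℝ := ∑ l : N.links with l.1.2 = n, x l

/-- The maximum in-degree. -/
def dmax : ℕ := Finset.univ.sup fun n : ι => (Finset.univ.filter fun l : N.links => l.1.2 = n).card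

/-- The maximum over all `(n, c)` of the (one-sided) derivative at `0` of the utility functions. -/
def β : ℝ := ⨆ p : ι × ι, derivWithin (N.U p.1 p.2) (Set.Ici 0) 0

def γ : ℝ := N.Rmax + N.dmax * N.muMax

/-- The perturbation `θ_n`, the same for all nodes. -/
def θ (V : ℝ) : ℝ := N.δ * N.β * V + N.Pmax

/-- Total utility of a rate vector. -/
def Utot (r : ι → ι → ℝ) : ℝ := ∑ n, ∑ c, N.U n c (r n c)

/-- The decisions taken in a network and the resulting queues, as processes on `Ω`. -/
structure Run (Ω : Type*) where
  /-- `R t ω n c`: commodity `c` data admitted at node `n` -/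
  R : ℕ → Ω → ι → ι → ℝ
  /-- power allocation vector -/
  P : ℕ → Ω → N.links → ℝ
  /-- harvested energy -/
  e : ℕ → Ω → ι → ℝ
  /-- `mu t ω l c`: rate allocated to commodity `c` over link `l` -/
  mu : ℕ → Ω → N.links → ι → ℝ
  /-- `sent t ω l c`: commodity `c` data actually sent over link `l`; smaller than the allocated
  rate when the node has not enough data to fill the allocated rates -/
  sent : ℕ → Ω → N.links → ι → ℝ
  /-- `Q t ω n c`: commodity `c` data queued at node `n` -/
  Q : ℕ → Ω → ι → ι → ℝ
  /-- energy queues -/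
  E : ℕ → Ω → ι → ℝ

variable {N} {Ω : Type*} {m : MeasurableSpace Ω}

/-- The decisions are feasible and based on the available information, and the queues follow
their dynamics, starting empty. -/
structure Run.IsFeasible (X : N.Run Ω) (ℱ : Filtration ℕ m) (S : ℕ → Ω → 𝒮) (H : ℕ → Ω → ℋ) :
    Prop where
  measurable_R : ∀ t n c, Measurable[ℱ t] fun ω => X.R t ω n c
  measurable_P : ∀ t l, Measurable[ℱ t] fun ω => X.P t ω l
  measurable_e : ∀ t n, Measurable[ℱ t] fun ω => X.e t ω n
  measurable_mu : ∀ t l c, Measurable[ℱ t] fun ω => X.mu t ω l c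
  measurable_sent : ∀ t l c, Measurable[ℱ t] fun ω => X.sent t ω l c
  R_mem : ∀ t ω n c, X.R t ω n c ∈ Set.Icc 0 N.Rmax
  P_mem : ∀ t ω, X.P t ω ∈ N.powerSet (S t ω)
  /-- energy availability -/
  P_le : ∀ t ω n, N.outSum (X.P t ω) n ≤ X.E t ω n
  e_mem : ∀ t ω n, X.e t ω n ∈ Set.Icc 0 (N.harvest (H t ω) n)
  mu_nonneg : ∀ t ω l c, 0 ≤ X.mu t ω l c
  mu_sum_le : ∀ t ω l, ∑ c, X.mu t ω l c ≤ N.rate (S t ω) (X.P t ω) l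
  sent_nonneg : ∀ t ω l c, 0 ≤ X.sent t ω l c
  sent_le : ∀ t ω l c, X.sent t ω l c ≤ X.mu t ω l c
  /-- a node sends as much as the allocated rates and its backlog permit -/
  sent_sum : ∀ t ω n c, N.outSum (fun l => X.sent t ω l c) n =
    min (X.Q t ω n c) (N.outSum (fun l => X.mu t ω l c) n)
  Q_zero : ∀ ω n c, X.Q 0 ω n c = 0
  /-- data that reach their destination leave the network -/
  Q_dest : ∀ t ω c, X.Q t ω c c = 0
  Q_step : ∀ t ω n c, n ≠ c → X.Q (t + 1) ω n c =
    max (X.Q t ω n c - N.outSum (fun l => X.mu t ω l c) n) 0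
      + N.inSum (fun l => X.sent t ω l c) n + X.R t ω n c
  E_zero : ∀ ω n, X.E 0 ω n = 0
  E_step : ∀ t ω n, X.E (t + 1) ω n = X.E t ω n - N.outSum (X.P t ω) n + X.e t ω n

/-- The expected admitted rates, averaged over the first `t` slots. -/
def Run.avgRate (X : N.Run Ω) (Pr : Measure Ω) (t : ℕ) (n c : ι) : ℝ :=
  (1 / (t : ℝ)) * ∑ τ ∈ Finset.range t, ∫ ω, X.R τ ω n c ∂Pr

/-- The time average rates: the lower limits of the averages, for each `(n, c)`. -/
def Run.rbar (X : N.Run Ω) (Pr : Measure Ω) (n c : ι) : ℝ :=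
  liminf (fun t => X.avgRate Pr t n c) atTop

/-- Stability: the upper limit of the averaged expected total backlog is finite. -/
def Run.IsStable (X : N.Run Ω) (Pr : Measure Ω) : Prop :=
  ∃ B : ℝ, ∀ᶠ t : ℕ in atTop,
    (1 / (t : ℝ)) * ∑ τ ∈ Finset.range t, ∑ n, ∑ c, ∫ ω, X.Q τ ω n c ∂Pr ≤ B

/-- Storage devices of some finite capacity suffice. -/
def Run.HasFiniteStorage (X : N.Run Ω) : Prop :=
  ∃ B : ℝ, ∀ t ω n, X.E t ω n ≤ B

/-- The weight of commodity `c` over link `l`. -/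
def Run.weight (X : N.Run Ω) (t : ℕ) (ω : Ω) (l : N.links) (c : ι) : ℝ :=
  max (X.Q t ω l.1.1 c - X.Q t ω l.1.2 c - N.γ) 0

/-- The weight of link `l`, the largest weight of a commodity over it. -/
def Run.linkWeight (X : N.Run Ω) (t : ℕ) (ω : Ω) (l : N.links) : ℝ :=
  ⨆ c, X.weight t ω l c

/-- The function that the power allocation maximizes, in channel state `s`. -/
def Run.G (X : N.Run Ω) (V : ℝ) (t : ℕ) (ω : Ω) (s : 𝒮) (P : N.links → ℝ) : ℝ :=
  ∑ n, (N.outSum (fun l => N.rate s P l * X.linkWeight t ω l) n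
    + (X.E t ω n - N.θ V) * N.outSum P n)

/-- The run is produced by the Energy-limited Scheduling Algorithm with parameter `V` (with an
arbitrary choice among maximizers where there are several). -/
structure Run.IsESA (X : N.Run Ω) (V : ℝ) (ℱ : Filtration ℕ m) (S : ℕ → Ω → 𝒮)
    (H : ℕ → Ω → ℋ) : Prop where
  feasible : X.IsFeasible ℱ S H
  harvesting : ∀ t ω n, X.e t ω n = if X.E t ω n < N.θ V then N.harvest (H t ω) n else 0
  admission : ∀ t ω n c,
    IsMaxOn (fun r => V * N.U n c r - X.Q t ω n c * r) (Set.Icc 0 N.Rmax) (X.R t ω n c)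
  power : ∀ t ω, IsMaxOn (X.G V t ω (S t ω))
    {P | P ∈ N.powerSet (S t ω) ∧ ∀ n, N.outSum P n ≤ X.E t ω n} (X.P t ω)
  routing : ∀ t ω l, ∃ c', X.weight t ω l c' = X.linkWeight t ω l ∧
    X.mu t ω l c' = (if 0 < X.weight t ω l c' then N.rate (S t ω) (X.P t ω) l else 0) ∧
    ∀ c, c ≠ c' → X.mu t ω l c = 0

variable (N)

/-- The optimal utility: the supremum of `Utot` at the time average rates over all feasible
policies that keep the network stable with storage devices of finite capacity. The policies may be
randomized: the probability space and the information are arbitrary, only the law of the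
channel and energy states is given. -/
def optimalUtility (KS : Matrix 𝒮 𝒮 ℝ) (KH : Matrix ℋ ℋ ℝ) (αS : 𝒮 → ℝ) (αH : ℋ → ℝ) : ℝ :=
  sSup {u : ℝ | ∃ (Ω : Type) (m : MeasurableSpace Ω) (Pr : Measure Ω) (ℱ : Filtration ℕ m)
    (S : ℕ → Ω → 𝒮) (H : ℕ → Ω → ℋ) (X : N.Run Ω), IsProbabilityMeasure Pr ∧
    IsMarkovPair Pr ℱ KS KH αS αH S H ∧ X.IsFeasible ℱ S H ∧ X.IsStable Pr ∧ X.HasFiniteStorage ∧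
    u = N.Utot (X.rbar Pr)}

end EnergyNetwork

end

/-! The argument is drift plus penalty, with the quadratic Lyapunov function in the backlogs and in
`E - θ`, and with the Poisson equation handling the Markov dependence.

The bounds of (a) hold pathwise. A commodity enters a node over a link only if the sender's queue
exceeds that node's by more than `γ`, which covers all that can arrive in a slot; otherwise only
admission feeds the queue, and it stops above `β V` because `U r ≤ β r` (`U_le_β_mul`). Hence link
weights are at most `β V`, so at a node with `E < Pmax` power costs more than the rate it buys, and
the energy constraint never binds (`G_le`): the algorithm maximizes `G` over the whole power set.

For (b), a stable competitor is reduced to a stationary plan (`exists_isStationaryPlan`): along an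
ultrafilter on which backlog divided by time tends to zero, its flows and powers are averaged given
the channel state, its harvests given the energy state. The plan is balanced in the mean, and each
linear functional of it is dominated by feasible power vectors. As the algorithm optimizes slot by
slot, its drift minus `V` times utility is at most that of the plan plus a constant (`drift_le`).

What remains is queue times a function of the current state, which is correlated with the queue. By
the Poisson equation such a function is its mean plus a telescoping term up to a conditionally
centred one (`sum_integral_mul_le`). Queues move by amounts independent of `V`, so the error per
slot is independent of `V`, while boundary terms vanish on averaging over time. Dividing by `V` and
applying Jensen's inequality gives the gap `C / V`. -/

noncomputable section

/-! ### The Poisson equation of an irreducible stochastic matrix -/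

section Poisson

variable {S : Type*} [Fintype S] [DecidableEq S] {K : Matrix S S ℝ}

/-- Minimum principle: at a minimizer the average over successors cannot exceed the minimum, so
every successor is a minimizer, and irreducibility spreads this to all states. -/
theorem eq_of_superharmonic (hK : K ∈ Matrix.rowStochastic ℝ S) (hirr : K.IsIrreducible)
    {f : S → ℝ} (hf : ∀ x, ∑ y, K x y * f y ≤ f x) (x y : S) : f x = f y := by
  have hne : Nonempty S := ⟨x⟩
  obtain ⟨x₀, hx₀⟩ := Finite.exists_min f
  have key : ∀ x, f x = f x₀ → ∀ y, 0 < K x y → f y = f x₀ := by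
    intro x hx y hxy
    have h1 : ∑ z, K x z * (f z - f x₀) ≤ 0 := by
      have h2 := hf x
      have h3 := Matrix.sum_row_of_mem_rowStochastic hK x
      simp only [mul_sub, Finset.sum_sub_distrib, ← Finset.sum_mul, h3]
      linarith
    have h0 : ∀ z, 0 ≤ K x z * (f z - f x₀) := fun z =>
      mul_nonneg (hirr.nonneg x z) (sub_nonneg.2 (hx₀ z))
    have h4 : K x y * (f y - f x₀) ≤ 0 :=
      (Finset.single_le_sum (f := fun z => K x z * (f z - f x₀)) (fun z _ => h0 z)
        (Finset.mem_univ y)).trans h1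
    have h5 : f y - f x₀ ≤ 0 := by
      by_contra hc
      push Not at hc
      exact absurd h4 (not_le.2 (mul_pos hxy hc))
    exact le_antisymm (by linarith) (hx₀ y)
  have all : ∀ z, f z = f x₀ := by
    intro z
    let : Quiver S := K.toQuiver
    obtain ⟨p, -⟩ := hirr.connected x₀ z
    induction p with
    | nil => rfl
    | cons p e ih => exact key _ ih _ e.down
  rw [all x, all y]

theorem exists_poisson_solution (hK : K ∈ Matrix.rowStochastic ℝ S) (hirr : K.IsIrreducible) :
    ∃ (π : S → ℝ) (F : S → S → ℝ), (∀ s, 0 < π s) ∧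
      ∀ s x, F s x - ∑ y, K x y * F s y = (if x = s then 1 else 0) - π s := by
  cases isEmpty_or_nonempty S with
  | inl h => exact ⟨fun _ => 0, fun _ _ => 0, fun s => h.elim s, fun s => h.elim s⟩
  | inr h =>
    obtain ⟨s₀⟩ := id h
    have hmin : ∀ f : S → ℝ, ∃ x, f x - ∑ y, K x y * f y ≤ 0 := by
      intro f
      obtain ⟨x, hx⟩ := Finite.exists_min f
      refine ⟨x, ?_⟩
      have h3 := Matrix.sum_row_of_mem_rowStochastic hK x
      have : ∑ y, K x y * f x ≤ ∑ y, K x y * f y :=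
        Finset.sum_le_sum fun y _ => mul_le_mul_of_nonneg_left (hx y) (hirr.nonneg x y)
      rw [← Finset.sum_mul, h3] at this
      linarith
    -- The rank-one term `f s₀` removes the constants from the kernel of `1 - K`. If `T f = 0`, the
    -- extrema of `f` force `f s₀ = 0`; then `f` is harmonic, hence constant, hence zero.
    let T : (S → ℝ) →ₗ[ℝ] (S → ℝ) :=
      { toFun := fun f x => f x - ∑ y, K x y * f y + f s₀
        map_add' := fun f g => by
          ext x
          simp only [Pi.add_apply, mul_add, Finset.sum_add_distrib]
          ring
        map_smul' := fun c f => by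
          ext x
          simp only [Pi.smul_apply, smul_eq_mul, RingHom.id_apply, mul_add, mul_sub, Finset.mul_sum]
          congr 2
          exact Finset.sum_congr rfl fun y _ => by ring }
    have hT : ∀ f x, T f x = f x - ∑ y, K x y * f y + f s₀ := fun f x => rfl
    have hinj : Function.Injective T := by
      rw [← LinearMap.ker_eq_bot, LinearMap.ker_eq_bot']
      intro f hf
      have hf' : ∀ x, f x - ∑ y, K x y * f y + f s₀ = 0 := fun x => by
        rw [← hT, hf]; rfl
      obtain ⟨x, hx⟩ := hmin f
      obtain ⟨y, hy⟩ := hmin (-f)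
      have h1 := hf' x
      have h2 := hf' y
      simp only [Pi.neg_apply, mul_neg, Finset.sum_neg_distrib] at hy
      have h3 : f s₀ = 0 := by linarith
      ext z
      rw [eq_of_superharmonic hK hirr (f := f) (fun x => by linarith [hf' x]) z s₀, h3]
      rfl
    have hsurj := LinearMap.injective_iff_surjective.1 hinj
    choose F hF using fun s : S => hsurj fun x => if x = s then 1 else 0
    have hFe : ∀ s x, F s x - ∑ y, K x y * F s y = (if x = s then 1 else 0) - F s s₀ := by
      intro s x
      have := congrFun (hF s) x
      rw [hT] at this
      linarith
    refine ⟨fun s => F s s₀, F, fun s => ?_, hFe⟩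
    have h0 : 0 ≤ F s s₀ := by
      obtain ⟨x, hx⟩ := hmin (F s)
      rw [hFe] at hx
      have : (0 : ℝ) ≤ if x = s then 1 else 0 := by split_ifs <;> norm_num
      linarith
    -- If `π s` vanished, `F s` would be superharmonic, hence constant, contradicting the value `1`
    -- of the right-hand side at `s`.
    refine lt_of_le_of_ne h0 fun h => ?_
    have hc := eq_of_superharmonic hK hirr (f := F s) fun x => by
      have := hFe s x
      have h1 : (0 : ℝ) ≤ if x = s then 1 else 0 := by split_ifs <;> norm_num
      linarith
    have h1 := hFe s s
    have h3 := Matrix.sum_row_of_mem_rowStochastic hK s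
    simp only [hc _ s₀, ← Finset.sum_mul, h3, if_true] at h1
    linarith

end Poisson

/-! ### Chains observed by a filtration -/

section Chain

variable {𝒮 Ω : Type*} {m : MeasurableSpace Ω}

theorem integrable_of_abs_le {Pr : Measure Ω} [IsProbabilityMeasure Pr] {Z : Ω → ℝ} {D : ℝ}
    (hZ : Measurable Z) (hD : ∀ ω, |Z ω| ≤ D) : Integrable Z Pr :=
  Integrable.of_bound hZ.aestronglyMeasurable D (ae_of_all _ hD)

theorem abs_integral_le_of_abs_le {Pr : Measure Ω} [IsProbabilityMeasure Pr] {Z : Ω → ℝ} {D : ℝ}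
    (hD : ∀ ω, |Z ω| ≤ D) : |∫ ω, Z ω ∂Pr| ≤ D := by
  have := norm_integral_le_of_norm_le_const (μ := Pr) (f := Z) (C := D) (ae_of_all _ hD)
  simpa using this

/-- `S` is a Markov chain with transition matrix `K` which `ℱ` does not anticipate. -/
structure IsMarkovChainFor [DecidableEq 𝒮] (Pr : Measure Ω) (ℱ : Filtration ℕ m) (K : Matrix 𝒮 𝒮 ℝ)
    (S : ℕ → Ω → 𝒮) : Prop where
  measurableSet_eq : ∀ t s, MeasurableSet[ℱ t] {ω | S t ω = s}
  integral_step : ∀ (t : ℕ) (Z : Ω → ℝ) (D : ℝ), Measurable[ℱ t] Z → (∀ ω, |Z ω| ≤ D) → ∀ s,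
    ∫ ω, Z ω * (if S (t + 1) ω = s then 1 else 0) ∂Pr = ∫ ω, Z ω * K (S t ω) s ∂Pr

theorem measurable_comp_of_measurableSet_eq [Fintype 𝒮] {m' : MeasurableSpace Ω} {S : Ω → 𝒮}
    (hS : ∀ s, MeasurableSet {ω | S ω = s}) (f : 𝒮 → ℝ) : Measurable fun ω => f (S ω) := by
  classical
  have : (fun ω => f (S ω)) = fun ω => ∑ s, if S ω = s then f s else 0 := by
    ext ω; simp
  rw [this]
  exact Finset.measurable_sum _ fun s _ => Measurable.ite (hS s) measurable_const measurable_const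

namespace IsMarkovPair

variable {ℋ : Type*} {Pr : Measure Ω} {ℱ : Filtration ℕ m} {KS : Matrix 𝒮 𝒮 ℝ}
  {KH : Matrix ℋ ℋ ℝ} {αS : 𝒮 → ℝ} {αH : ℋ → ℝ} {S : ℕ → Ω → 𝒮} {H : ℕ → Ω → ℋ}

theorem integral_step [DecidableEq 𝒮] [DecidableEq ℋ] [IsProbabilityMeasure Pr]
    (h : IsMarkovPair Pr ℱ KS KH αS αH S H) (t : ℕ) {Z : Ω → ℝ} {D : ℝ}
    (hZ : Measurable[ℱ t] Z) (hD : ∀ ω, |Z ω| ≤ D) (s : 𝒮) (j : ℋ) :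
    ∫ ω, Z ω * (if S (t + 1) ω = s ∧ H (t + 1) ω = j then 1 else 0) ∂Pr
      = ∫ ω, Z ω * (KS (S t ω) s * KH (H t ω) j) ∂Pr := by
  have hA : MeasurableSet {ω | S (t + 1) ω = s ∧ H (t + 1) ω = j} :=
    ((ℱ.le _ _ (h.measurable_S (t + 1) s)).inter (ℱ.le _ _ (h.measurable_H (t + 1) j)))
  set A := {ω | S (t + 1) ω = s ∧ H (t + 1) ω = j}
  have hI : Integrable (A.indicator fun _ => (1 : ℝ)) Pr :=
    (integrable_const (1 : ℝ)).indicator hA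
  have h1 := condExp_stronglyMeasurable_mul_of_bound (μ := Pr) (ℱ.le t) hZ.stronglyMeasurable hI D
    (ae_of_all _ hD)
  calc ∫ ω, Z ω * (if S (t + 1) ω = s ∧ H (t + 1) ω = j then 1 else 0) ∂Pr
      = ∫ ω, (Z * A.indicator fun _ => (1 : ℝ)) ω ∂Pr := by
        refine integral_congr_ae (ae_of_all _ fun ω => ?_)
        simp [A, Set.indicator_apply]
    _ = ∫ ω, (Pr[Z * A.indicator (fun _ => (1 : ℝ)) | ℱ t]) ω ∂Pr := (integral_condExp (ℱ.le t)).symm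
    _ = _ := by
        refine integral_congr_ae ?_
        filter_upwards [h1, h.step t s j] with ω h1 h2
        rw [h1, Pi.mul_apply, h2]

/-- Summing the product transition law over the other coordinate, whose rows sum to one, leaves a
Markov chain for the same filtration. Only the two marginal chains are needed later, never the
product chain. -/
theorem isMarkovChainFor_left [Fintype 𝒮] [DecidableEq 𝒮] [Fintype ℋ] [DecidableEq ℋ]
    [IsProbabilityMeasure Pr] (h : IsMarkovPair Pr ℱ KS KH αS αH S H)
    (hK : KH ∈ Matrix.rowStochastic ℝ ℋ) : IsMarkovChainFor Pr ℱ KS S where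
  measurableSet_eq := h.measurable_S
  integral_step t Z D hZ hD s := by
    have hm1 : ∀ j, Measurable fun ω => Z ω *
        (if S (t + 1) ω = s ∧ H (t + 1) ω = j then (1 : ℝ) else 0) := fun j =>
      (hZ.mono (ℱ.le t) le_rfl).mul (Measurable.ite ((ℱ.le _ _ (h.measurable_S (t + 1) s)).inter
        (ℱ.le _ _ (h.measurable_H (t + 1) j))) measurable_const measurable_const)
    have hD0 : ∀ ω, 0 ≤ D := fun ω => (abs_nonneg _).trans (hD ω)
    have hm2 : ∀ j, Measurable fun ω => Z ω * (KS (S t ω) s * KH (H t ω) j) := fun j =>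
      (hZ.mono (ℱ.le t) le_rfl).mul
        ((measurable_comp_of_measurableSet_eq (fun i => ℱ.le _ _ (h.measurable_S t i))
            fun i => KS i s).mul
          (measurable_comp_of_measurableSet_eq (fun i => ℱ.le _ _ (h.measurable_H t i))
            fun i => KH i j))
    have hi1 : ∀ j, Integrable (fun ω => Z ω *
        (if S (t + 1) ω = s ∧ H (t + 1) ω = j then (1 : ℝ) else 0)) Pr := fun j =>
      integrable_of_abs_le (D := D) (hm1 j) fun ω => by
        have := hD0 ω
        split_ifs <;> simp [hD ω, this]
    have hi2 : ∀ j, Integrable (fun ω => Z ω * (KS (S t ω) s * KH (H t ω) j)) Pr := fun j =>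
      integrable_of_abs_le (D := D * ∑ a, ∑ b, |KS a s * KH b j|) (hm2 j) fun ω => by
        rw [abs_mul]
        refine mul_le_mul (hD ω) ?_ (abs_nonneg _) (hD0 ω)
        exact (Finset.single_le_sum (f := fun b => |KS (S t ω) s * KH b j|)
          (fun _ _ => abs_nonneg _) (Finset.mem_univ (H t ω))).trans
          (Finset.single_le_sum (f := fun a => ∑ b, |KS a s * KH b j|)
          (fun _ _ => Finset.sum_nonneg fun _ _ => abs_nonneg _) (Finset.mem_univ (S t ω)))
    have e1 : (fun ω => Z ω * (if S (t + 1) ω = s then (1 : ℝ) else 0)) = fun ω => ∑ j, Z ω *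
        (if S (t + 1) ω = s ∧ H (t + 1) ω = j then (1 : ℝ) else 0) := by
      ext ω
      rw [← Finset.mul_sum]
      congr 1
      by_cases hs : S (t + 1) ω = s <;> simp [hs]
    have e2 : (fun ω => Z ω * KS (S t ω) s) = fun ω => ∑ j, Z ω *
        (KS (S t ω) s * KH (H t ω) j) := by
      ext ω
      rw [← Finset.mul_sum, ← Finset.mul_sum, Matrix.sum_row_of_mem_rowStochastic hK, mul_one]
    rw [e1, e2, integral_finsetSum _ fun j _ => hi1 j, integral_finsetSum _ fun j _ => hi2 j]
    exact Finset.sum_congr rfl fun j _ => h.integral_step t hZ hD s j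

theorem swap (h : IsMarkovPair Pr ℱ KS KH αS αH S H) : IsMarkovPair Pr ℱ KH KS αH αS H S where
  measurable_S := h.measurable_H
  measurable_H := h.measurable_S
  init s j := by
    rw [mul_comm, ← h.init]
    congr 1
    ext ω
    exact and_comm
  step t s j := by
    have := h.step t j s
    simp only [and_comm, mul_comm (KH _ _)] at this ⊢
    exact this

theorem isMarkovChainFor_right [Fintype 𝒮] [DecidableEq 𝒮] [Fintype ℋ] [DecidableEq ℋ]
    [IsProbabilityMeasure Pr] (h : IsMarkovPair Pr ℱ KS KH αS αH S H)
    (hK : KS ∈ Matrix.rowStochastic ℝ 𝒮) : IsMarkovChainFor Pr ℱ KH H :=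
  h.swap.isMarkovChainFor_left hK

end IsMarkovPair

/-- A bound for the solutions of the Poisson equation with right-hand sides bounded by `1`. -/
def poissonNorm [Fintype 𝒮] (F : 𝒮 → 𝒮 → ℝ) : ℝ := ∑ s, ∑ x, |F s x|

theorem poissonNorm_nonneg [Fintype 𝒮] (F : 𝒮 → 𝒮 → ℝ) : 0 ≤ poissonNorm F :=
  Finset.sum_nonneg fun _ _ => Finset.sum_nonneg fun _ _ => abs_nonneg _

namespace IsMarkovChainFor

variable [Fintype 𝒮] [DecidableEq 𝒮]
  {Pr : Measure Ω} {ℱ : Filtration ℕ m} {K : Matrix 𝒮 𝒮 ℝ}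
  {S : ℕ → Ω → 𝒮} {π : 𝒮 → ℝ} {F : 𝒮 → 𝒮 → ℝ}

theorem measurable_comp (h : IsMarkovChainFor Pr ℱ K S) (t : ℕ) (f : 𝒮 → ℝ) :
    Measurable[ℱ t] fun ω => f (S t ω) :=
  measurable_comp_of_measurableSet_eq (h.measurableSet_eq t) f

variable [IsProbabilityMeasure Pr]

theorem integrable_mul_comp (h : IsMarkovChainFor Pr ℱ K S) {Z : Ω → ℝ} {D : ℝ}
    (hZ : Measurable Z) (hD : ∀ ω, |Z ω| ≤ D) (t : ℕ) (f : 𝒮 → ℝ) :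
    Integrable (fun ω => Z ω * f (S t ω)) Pr :=
  integrable_of_abs_le (D := D * ∑ s, |f s|)
    (hZ.mul ((h.measurable_comp t f).mono (ℱ.le t) le_rfl)) fun ω => by
      rw [abs_mul]
      exact mul_le_mul (hD ω) (Finset.single_le_sum (f := fun s => |f s|)
        (fun _ _ => abs_nonneg _) (Finset.mem_univ _)) (abs_nonneg _)
        ((abs_nonneg _).trans (hD ω))

theorem integral_mul_comp_step (h : IsMarkovChainFor Pr ℱ K S) {Z : Ω → ℝ} {D : ℝ} {t : ℕ}
    (hZ : Measurable[ℱ t] Z) (hD : ∀ ω, |Z ω| ≤ D) (f : 𝒮 → ℝ) :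
    ∫ ω, Z ω * f (S (t + 1) ω) ∂Pr = ∫ ω, Z ω * ∑ y, K (S t ω) y * f y ∂Pr := by
  have hZ' := hZ.mono (ℱ.le t) le_rfl
  have e1 : (fun ω => Z ω * f (S (t + 1) ω)) = fun ω => ∑ y, f y *
      (Z ω * if S (t + 1) ω = y then 1 else 0) := by
    ext ω; simp [mul_comm]
  have e2 : (fun ω => Z ω * ∑ y, K (S t ω) y * f y) = fun ω => ∑ y, f y *
      (Z ω * K (S t ω) y) := by
    ext ω
    rw [Finset.mul_sum]
    exact Finset.sum_congr rfl fun y _ => by ring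
  rw [e1, e2, integral_finsetSum _ fun y _ =>
      (h.integrable_mul_comp hZ' hD (t + 1) fun x => if x = y then 1 else 0).const_mul _,
    integral_finsetSum _ fun y _ =>
      (h.integrable_mul_comp hZ' hD t fun x => K x y).const_mul _]
  refine Finset.sum_congr rfl fun y _ => ?_
  rw [integral_const_mul, integral_const_mul, h.integral_step t Z D hZ hD]

/-- For `f = ∑ s, g s * F s` the Poisson equation reads `g = mean + f - K f`. Since `Z t` is known
at time `t`, `K f (S t)` may be replaced by `f (S (t + 1))` under the integral, and summation by
parts leaves the increments of `Z`. The size `D` of `Z`, which grows with `V` in the application,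
enters only the term free of `T`; the term linear in `T` involves only `D'`. -/
theorem sum_integral_mul_le (h : IsMarkovChainFor Pr ℱ K S)
    (hF : ∀ s x, F s x - ∑ y, K x y * F s y = (if x = s then 1 else 0) - π s)
    {g : 𝒮 → ℝ} {G : ℝ} (hg : ∀ s, |g s| ≤ G) {Z : ℕ → Ω → ℝ} (hZ : ∀ t, Measurable[ℱ t] (Z t))
    {D D' : ℝ} (hD : ∀ t ω, |Z t ω| ≤ D) (hD' : ∀ t ω, |Z (t + 1) ω - Z t ω| ≤ D') (T : ℕ) :
    ∑ t ∈ Finset.range T, ∫ ω, Z t ω * g (S t ω) ∂Pr ≤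
      (∑ s, π s * g s) * ∑ t ∈ Finset.range T, ∫ ω, Z t ω ∂Pr
        + T * (D' * (G * poissonNorm F)) + 2 * (D * (G * poissonNorm F)) := by
  have hne : Nonempty Ω := nonempty_of_isProbabilityMeasure Pr
  obtain ⟨ω₀⟩ := hne
  have hD0 : 0 ≤ D := (abs_nonneg _).trans (hD 0 ω₀)
  have hD'0 : 0 ≤ D' := (abs_nonneg _).trans (hD' 0 ω₀)
  have hG0 : 0 ≤ G := (abs_nonneg _).trans (hg (S 0 ω₀))
  set B := G * poissonNorm F
  have hZ' : ∀ t, Measurable (Z t) := fun t => (hZ t).mono (ℱ.le t) le_rfl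
  set f : 𝒮 → ℝ := fun x => ∑ s, g s * F s x with hf
  have hfB : ∀ x, |f x| ≤ B := fun x => by
    simp only [B, poissonNorm, Finset.mul_sum, hf]
    refine (Finset.abs_sum_le_sum_abs _ _).trans (Finset.sum_le_sum fun s _ => ?_)
    rw [abs_mul, ← Finset.mul_sum]
    exact mul_le_mul (hg s) (Finset.single_le_sum (f := fun x => |F s x|)
      (fun _ _ => abs_nonneg _) (Finset.mem_univ x)) (abs_nonneg _) hG0
  have hfp : ∀ x, g x = (∑ s, π s * g s) + f x - ∑ y, K x y * f y := by
    intro x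
    have h1 : ∑ y, K x y * f y = ∑ s, g s * ∑ y, K x y * F s y := by
      simp only [hf, Finset.mul_sum]
      rw [Finset.sum_comm]
      exact Finset.sum_congr rfl fun s _ => Finset.sum_congr rfl fun y _ => by ring
    have h2 : ∑ s, g s * (F s x - ∑ y, K x y * F s y) = g x - ∑ s, π s * g s := by
      simp only [hF, mul_sub, Finset.sum_sub_distrib]
      congr 1
      · simp
      · exact Finset.sum_congr rfl fun s _ => by ring
    simp only [mul_sub, Finset.sum_sub_distrib] at h2
    rw [h1]
    simp only [hf]
    linarith
  have hB : 0 ≤ B := mul_nonneg hG0 (poissonNorm_nonneg F)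
  set a : ℕ → ℝ := fun t => ∫ ω, Z t ω * f (S t ω) ∂Pr with ha
  have habs : ∀ t, |a t| ≤ D * B := fun t => abs_integral_le_of_abs_le fun ω => by
    rw [abs_mul]
    exact mul_le_mul (hD t ω) (hfB _) (abs_nonneg _) hD0
  have hstep : ∀ t, ∫ ω, Z t ω * g (S t ω) ∂Pr ≤
      (∑ s, π s * g s) * ∫ ω, Z t ω ∂Pr + D' * B + (a t - a (t + 1)) := by
    intro t
    have e1 : (fun ω => Z t ω * g (S t ω)) = fun ω => (∑ s, π s * g s) * Z t ω
        + Z t ω * f (S t ω) - Z t ω * ∑ y, K (S t ω) y * f y := by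
      ext ω
      rw [hfp (S t ω)]
      ring
    have hi : ∀ u, Integrable (fun ω => Z t ω * f (S u ω)) Pr := fun u =>
      h.integrable_mul_comp (hZ' t) (hD t) u f
    have hZi : Integrable (fun ω => (∑ s, π s * g s) * Z t ω) Pr :=
      (integrable_of_abs_le (hZ' t) (hD t)).const_mul _
    have hZf : Integrable (fun ω => (∑ s, π s * g s) * Z t ω + Z t ω * f (S t ω)) Pr :=
      hZi.add (hi t)
    rw [e1, integral_sub hZf
      (h.integrable_mul_comp (hZ' t) (hD t) t fun x => ∑ y, K x y * f y),
      integral_add hZi (hi t), integral_const_mul, ← h.integral_mul_comp_step (hZ t) (hD t)]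
    -- Cost of changing the weight from `Z t` to `Z (t + 1)`, which makes the sequence `a`
    -- telescope.
    have h3 : |∫ ω, (Z (t + 1) ω * f (S (t + 1) ω) - Z t ω * f (S (t + 1) ω)) ∂Pr| ≤ D' * B :=
      abs_integral_le_of_abs_le fun ω => by
        rw [← sub_mul, abs_mul]
        exact mul_le_mul (hD' t ω) (hfB _) (abs_nonneg _) hD'0
    rw [integral_sub (h.integrable_mul_comp (hZ' (t + 1)) (hD (t + 1)) (t + 1) f) (hi (t + 1))]
      at h3
    have h4 := abs_le.1 h3
    simp only [ha]
    linarith [h4.2, h4.1]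
  refine (Finset.sum_le_sum fun t _ => hstep t).trans ?_
  rw [Finset.sum_add_distrib, Finset.sum_add_distrib, Finset.sum_range_sub', ← Finset.mul_sum]
  have := (abs_le.1 (habs 0)).2
  have := (abs_le.1 (habs T)).1
  simp only [Finset.sum_const, Finset.card_range, nsmul_eq_mul]
  linarith

/-- With constant weight `1` the increments vanish, so expected occupation counts differ from `T * π
s` by a bounded amount, whatever the initial law. -/
theorem tendsto_avg_indicator (h : IsMarkovChainFor Pr ℱ K S)
    (hF : ∀ s x, F s x - ∑ y, K x y * F s y = (if x = s then 1 else 0) - π s) (s : 𝒮) :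
    Tendsto (fun t : ℕ => (1 / (t : ℝ)) * ∑ τ ∈ Finset.range t,
      ∫ ω, (if S τ ω = s then (1 : ℝ) else 0) ∂Pr) atTop (𝓝 (π s)) := by
  have hb : ∀ T : ℕ, |∑ τ ∈ Finset.range T, ∫ ω, (if S τ ω = s then (1 : ℝ) else 0) ∂Pr - T * π s|
      ≤ 2 * poissonNorm F := by
    intro T
    have h1 := h.sum_integral_mul_le hF (g := fun x => if x = s then 1 else 0) (G := 1)
      (fun x => by split_ifs <;> simp) (Z := fun _ _ => 1) (fun _ => measurable_const) (D := 1)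
      (D' := 0) (by simp) (by simp) T
    have h2 := h.sum_integral_mul_le hF (g := fun x => if x = s then -1 else 0) (G := 1)
      (fun x => by split_ifs <;> simp) (Z := fun _ _ => 1) (fun _ => measurable_const) (D := 1)
      (D' := 0) (by simp) (by simp) T
    have h3 : ∀ τ, ∫ ω, (if S τ ω = s then (-1 : ℝ) else 0) ∂Pr =
        -∫ ω, (if S τ ω = s then (1 : ℝ) else 0) ∂Pr := fun τ => by
      rw [← integral_neg]
      congr 1
      ext ω
      split_ifs <;> simp
    simp only [one_mul, h3, mul_ite, mul_one, mul_zero, mul_neg] at h1 h2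
    simp only [Finset.sum_neg_distrib, Finset.sum_ite_eq', Finset.mem_univ, if_true, integral_const,
      probReal_univ, smul_eq_mul, mul_one, Finset.sum_const, Finset.card_range, nsmul_eq_mul]
      at h1 h2
    rw [abs_le]
    constructor <;> nlinarith
  rw [tendsto_iff_norm_sub_tendsto_zero]
  refine squeeze_zero' (Eventually.of_forall fun _ => norm_nonneg _)
    ((eventually_gt_atTop 0).mono fun t (ht : 0 < t) => ?_)
    (tendsto_const_div_atTop_nhds_zero_nat (2 * poissonNorm F))
  have ht' : (0 : ℝ) < t := by exact_mod_cast ht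
  have e : ∀ x : ℝ, 1 / (t : ℝ) * x - π s = (x - t * π s) / t := fun x => by field_simp
  rw [Real.norm_eq_abs, e, abs_div, abs_of_pos ht']
  exact div_le_div_of_nonneg_right (hb t) ht'.le

end IsMarkovChainFor

end Chain

/-! ### Ultrafilter limits of conditional time averages -/

/-- A bounded sequence converges along every ultrafilter. -/
theorem exists_tendsto_ultrafilter {α : Type*} (𝒰 : Ultrafilter α) {u : α → ℝ} {D : ℝ}
    (hu : ∀ t, |u t| ≤ D) : ∃ x, Tendsto u 𝒰 (𝓝 x) := by
  obtain ⟨x, -, hx⟩ := (isCompact_Icc (a := -D) (b := D)).ultrafilter_le_nhds (𝒰.map u)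
    (by
      rw [le_principal_iff]
      exact Filter.mem_map.2 (Filter.univ_mem' fun t => abs_le.1 (hu t)))
  exact ⟨x, hx⟩

theorem abs_avg_le {u : ℕ → ℝ} {D : ℝ} (hu : ∀ t, |u t| ≤ D) (t : ℕ) :
    |(1 / (t : ℝ)) * ∑ τ ∈ Finset.range t, u τ| ≤ D := by
  rcases Nat.eq_zero_or_pos t with rfl | ht
  · simpa using (abs_nonneg _).trans (hu 0)
  have ht' : (0 : ℝ) < t := by exact_mod_cast ht
  rw [abs_mul, abs_of_pos (by positivity : 0 < 1 / (t : ℝ)), one_div, inv_mul_le_iff₀ ht']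
  refine (Finset.abs_sum_le_sum_abs _ _).trans ((Finset.sum_le_sum fun τ _ => hu τ).trans ?_)
  simp

/-- `A s` is the limit of the averages of `a` on the event `S = s`, divided by the limiting
frequency `π s > 0`. A linear bound that holds pathwise on this event passes to the limit. Testing
linear functionals replaces any explicit convex combination. -/
theorem IsMarkovChainFor.exists_conditional_average {𝒮 Ω I : Type*} {m : MeasurableSpace Ω} [Fintype 𝒮]
    [DecidableEq 𝒮] [Fintype I] {Pr : Measure Ω} [IsProbabilityMeasure Pr] {ℱ : Filtration ℕ m}
    {K : Matrix 𝒮 𝒮 ℝ} {S : ℕ → Ω → 𝒮} {π : 𝒮 → ℝ} {F : 𝒮 → 𝒮 → ℝ} (h : IsMarkovChainFor Pr ℱ K S)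
    (hπ : ∀ s, 0 < π s)
    (hF : ∀ s x, F s x - ∑ y, K x y * F s y = (if x = s then 1 else 0) - π s)
    {𝒰 : Ultrafilter ℕ} (h𝒰 : (𝒰 : Filter ℕ) ≤ atTop) {a : ℕ → Ω → I → ℝ}
    (ha : ∀ t i, Measurable fun ω => a t ω i) {D : ℝ} (hD : ∀ t ω i, |a t ω i| ≤ D) :
    ∃ A : 𝒮 → I → ℝ,
      (∀ i, Tendsto (fun t : ℕ => (1 / (t : ℝ)) * ∑ τ ∈ Finset.range t, ∫ ω, a τ ω i ∂Pr) 𝒰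
        (𝓝 (∑ s, π s * A s i))) ∧
      ∀ s (c : I → ℝ) (M : ℝ), (∀ τ ω, S τ ω = s → ∑ i, c i * a τ ω i ≤ M) →
        ∑ i, c i * A s i ≤ M := by
  set u : 𝒮 → I → ℕ → ℝ := fun s i τ => ∫ ω, a τ ω i * (if S τ ω = s then 1 else 0) ∂Pr with hu
  have hint : ∀ s i τ, Integrable (fun ω => a τ ω i * (if S τ ω = s then 1 else 0)) Pr :=
    fun s i τ => h.integrable_mul_comp (ha τ i) (fun ω => hD τ ω i) τ fun x => if x = s then 1 else 0
  have hubd : ∀ s i τ, |u s i τ| ≤ D := fun s i τ => abs_integral_le_of_abs_le fun ω => by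
    have := (abs_nonneg _).trans (hD τ ω i)
    split_ifs <;> simp [hD τ ω i, this]
  choose B hB using fun s i => exists_tendsto_ultrafilter 𝒰 (abs_avg_le (hubd s i))
  have hne : ∀ s, π s ≠ 0 := fun s => (hπ s).ne'
  refine ⟨fun s i => B s i / π s, fun i => ?_, fun s c M hM => ?_⟩
  · have e1 : ∀ τ, ∫ ω, a τ ω i ∂Pr = ∑ s, u s i τ := fun τ => by
      simp only [hu]
      rw [← integral_finsetSum _ fun s _ => hint s i τ]
      simp
    simp only [e1, mul_div_cancel₀ _ (hne _)]
    have := tendsto_finsetSum Finset.univ fun s _ => hB s i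
    refine this.congr fun t => ?_
    rw [Finset.sum_comm, Finset.mul_sum]
  · have h1 : Tendsto (fun t : ℕ => ∑ i, c i * ((1 / (t : ℝ)) * ∑ τ ∈ Finset.range t, u s i τ)) 𝒰
        (𝓝 (∑ i, c i * B s i)) := tendsto_finsetSum _ fun i _ => (hB s i).const_mul _
    have h2 := ((h.tendsto_avg_indicator hF s).mono_left h𝒰).const_mul M
    have h3 : ∑ i, c i * B s i ≤ M * π s := by
      refine le_of_tendsto_of_tendsto' h1 h2 fun t => ?_
      have e : ∑ i, c i * ((1 / (t : ℝ)) * ∑ τ ∈ Finset.range t, u s i τ) =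
          (1 / (t : ℝ)) * ∑ τ ∈ Finset.range t, ∑ i, c i * u s i τ := by
        rw [Finset.sum_comm, Finset.mul_sum]
        refine Finset.sum_congr rfl fun i _ => ?_
        rw [← Finset.mul_sum]
        ring
      rw [e, mul_left_comm]
      refine mul_le_mul_of_nonneg_left ?_ (by positivity)
      rw [Finset.mul_sum]
      refine Finset.sum_le_sum fun τ _ => ?_
      simp only [hu, ← integral_const_mul]
      rw [← integral_finsetSum _ fun i _ => (hint s i τ).const_mul _]
      refine integral_mono (integrable_finsetSum _ fun i _ => (hint s i τ).const_mul _)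
        (h.integrable_mul_comp measurable_const (fun _ => le_refl |M|) τ
          fun x => if x = s then 1 else 0) fun ω => ?_
      by_cases hs : S τ ω = s
      · simpa [hs] using hM τ ω hs
      · simp [hs]
    have e : ∑ i, c i * (B s i / π s) = (∑ i, c i * B s i) / π s := by
      rw [Finset.sum_div]
      exact Finset.sum_congr rfl fun i _ => by ring
    rwa [e, div_le_iff₀ (hπ s)]

namespace EnergyNetwork

variable {ι 𝒮 ℋ : Type*} [Fintype ι] [DecidableEq ι] {N : EnergyNetwork ι 𝒮 ℋ}

/-! ### Link sums -/

theorem outSum_nonneg {x : N.links → ℝ} (hx : ∀ l, 0 ≤ x l) (n : ι) : 0 ≤ N.outSum x n :=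
  Finset.sum_nonneg fun l _ => hx l

theorem inSum_nonneg {x : N.links → ℝ} (hx : ∀ l, 0 ≤ x l) (n : ι) : 0 ≤ N.inSum x n :=
  Finset.sum_nonneg fun l _ => hx l

theorem inSum_mono {x y : N.links → ℝ} (h : ∀ l, x l ≤ y l) (n : ι) :
    N.inSum x n ≤ N.inSum y n :=
  Finset.sum_le_sum fun l _ => h l

theorem sum_mul_outSum (z : ι → ℝ) (x : N.links → ℝ) :
    ∑ n, z n * N.outSum x n = ∑ l, z l.1.1 * x l := by
  simp only [outSum, Finset.sum_filter, Finset.mul_sum]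
  rw [Finset.sum_comm]
  refine Finset.sum_congr rfl fun l _ => ?_
  simp

theorem sum_mul_inSum (z : ι → ℝ) (x : N.links → ℝ) :
    ∑ n, z n * N.inSum x n = ∑ l, z l.1.2 * x l := by
  simp only [inSum, Finset.sum_filter, Finset.mul_sum]
  rw [Finset.sum_comm]
  refine Finset.sum_congr rfl fun l _ => ?_
  simp

variable (N)

/-- A bound on the total flow over the links into or out of a node. -/
def flowBound : ℝ := N.links.card * |N.muMax|

/-- A bound on the change of a data queue in a slot. -/
def queueStep : ℝ := N.flowBound + N.Rmax

/-- A bound on the change of an energy queue in a slot. -/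
def energyStep : ℝ := |N.Pmax| + |N.hmax|

theorem flowBound_nonneg : 0 ≤ N.flowBound := by unfold flowBound; positivity

theorem queueStep_nonneg : 0 ≤ N.queueStep := add_nonneg N.flowBound_nonneg N.Rmax_nonneg

variable {N}

theorem outSum_le_flowBound {x : N.links → ℝ} (hx : ∀ l, x l ≤ N.muMax) (n : ι) :
    N.outSum x n ≤ N.flowBound := by
  refine (Finset.sum_le_sum fun l _ => (hx l).trans (le_abs_self _)).trans ?_
  rw [Finset.sum_const, nsmul_eq_mul, flowBound]
  refine mul_le_mul_of_nonneg_right ?_ (abs_nonneg _)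
  have := Finset.card_filter_le (Finset.univ : Finset N.links) fun l => l.1.1 = n
  simp only [Finset.card_univ, Fintype.card_coe] at this
  exact_mod_cast this

theorem inSum_le_flowBound {x : N.links → ℝ} (hx : ∀ l, x l ≤ N.muMax) (n : ι) :
    N.inSum x n ≤ N.flowBound := by
  refine (Finset.sum_le_sum fun l _ => (hx l).trans (le_abs_self _)).trans ?_
  rw [Finset.sum_const, nsmul_eq_mul, flowBound]
  refine mul_le_mul_of_nonneg_right ?_ (abs_nonneg _)
  have := Finset.card_filter_le (Finset.univ : Finset N.links) fun l => l.1.2 = n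
  simp only [Finset.card_univ, Fintype.card_coe] at this
  exact_mod_cast this

/-! ### Feasible runs -/

namespace Run.IsFeasible

variable {Ω : Type*} {m : MeasurableSpace Ω} {X : N.Run Ω} {ℱ : Filtration ℕ m} {S : ℕ → Ω → 𝒮}
  {H : ℕ → Ω → ℋ}

theorem mu_le (h : X.IsFeasible ℱ S H) (t : ℕ) (ω : Ω) (l : N.links) (c : ι) :
    X.mu t ω l c ≤ N.muMax :=
  (Finset.single_le_sum (fun c _ => h.mu_nonneg t ω l c) (Finset.mem_univ c)).trans
    ((h.mu_sum_le t ω l).trans (N.rate_le _ _ (h.P_mem t ω) l))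

theorem P_nonneg (h : X.IsFeasible ℱ S H) (t : ℕ) (ω : Ω) (l : N.links) : 0 ≤ X.P t ω l :=
  N.power_nonneg _ _ (h.P_mem t ω) l

theorem outSum_P_le (h : X.IsFeasible ℱ S H) (t : ℕ) (ω : Ω) (n : ι) :
    N.outSum (X.P t ω) n ≤ N.Pmax :=
  N.power_sum_le _ _ (h.P_mem t ω) n

theorem P_le_Pmax (h : X.IsFeasible ℱ S H) (t : ℕ) (ω : Ω) (l : N.links) :
    X.P t ω l ≤ N.Pmax :=
  (Finset.single_le_sum (f := X.P t ω) (s := Finset.univ.filter fun l' : N.links => l'.1.1 = l.1.1)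
    (fun l _ => h.P_nonneg t ω l) (Finset.mem_filter.2 ⟨Finset.mem_univ l, rfl⟩)).trans
    (h.outSum_P_le t ω l.1.1)

theorem Q_nonneg (h : X.IsFeasible ℱ S H) (t : ℕ) (ω : Ω) (n c : ι) : 0 ≤ X.Q t ω n c := by
  cases t with
  | zero => exact (h.Q_zero ω n c).ge
  | succ t =>
    by_cases hnc : n = c
    · subst hnc
      exact (h.Q_dest _ ω n).ge
    · rw [h.Q_step t ω n c hnc]
      exact add_nonneg (add_nonneg (le_max_right _ _)
        (inSum_nonneg (fun l => h.sent_nonneg t ω l c) n)) (h.R_mem t ω n c).1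

theorem abs_Q_sub_le (h : X.IsFeasible ℱ S H) (t : ℕ) (ω : Ω) (n c : ι) :
    |X.Q (t + 1) ω n c - X.Q t ω n c| ≤ N.queueStep := by
  by_cases hnc : n = c
  · subst hnc
    simp [h.Q_dest, N.queueStep_nonneg]
  have h1 := inSum_nonneg (fun l => h.sent_nonneg t ω l c) n
  have h2 := inSum_le_flowBound (fun l => (h.sent_le t ω l c).trans (h.mu_le t ω l c)) n
  have h3 := outSum_nonneg (fun l => h.mu_nonneg t ω l c) n
  have h4 := outSum_le_flowBound (fun l => h.mu_le t ω l c) n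
  have h5 := h.R_mem t ω n c
  have h6 := h.Q_nonneg t ω n c
  have h7 := N.Rmax_nonneg
  rw [h.Q_step t ω n c hnc, abs_le, queueStep]
  constructor
  · linarith [le_max_left (X.Q t ω n c - N.outSum (fun l => X.mu t ω l c) n) 0, h5.1]
  · have : max (X.Q t ω n c - N.outSum (fun l => X.mu t ω l c) n) 0 ≤ X.Q t ω n c :=
      max_le (by linarith) h6
    linarith [h5.2]

theorem Q_le (h : X.IsFeasible ℱ S H) (t : ℕ) (ω : Ω) (n c : ι) :
    X.Q t ω n c ≤ t * N.queueStep := by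
  induction t with
  | zero => simp [h.Q_zero]
  | succ t ih =>
    have := (abs_le.1 (h.abs_Q_sub_le t ω n c)).2
    push_cast
    linarith

/-- Since `max (q - b) 0 = q - min q b`, counting data actually sent turns the truncated recursion
into exact conservation, which can be summed over time in expectation. -/
theorem Q_step_sent (h : X.IsFeasible ℱ S H) (t : ℕ) (ω : Ω) {n c : ι} (hnc : n ≠ c) :
    X.Q (t + 1) ω n c = X.Q t ω n c + (X.R t ω n c + N.inSum (fun l => X.sent t ω l c) n
      - N.outSum (fun l => X.sent t ω l c) n) := by
  rw [h.Q_step t ω n c hnc, h.sent_sum]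
  rcases le_total (X.Q t ω n c) (N.outSum (fun l => X.mu t ω l c) n) with hl | hl
  · rw [min_eq_left hl, max_eq_right (by linarith)]; ring
  · rw [min_eq_right hl, max_eq_left (by linarith)]; ring

theorem E_nonneg (h : X.IsFeasible ℱ S H) (t : ℕ) (ω : Ω) (n : ι) : 0 ≤ X.E t ω n := by
  cases t with
  | zero => exact (h.E_zero ω n).ge
  | succ t =>
    rw [h.E_step]
    linarith [h.P_le t ω n, (h.e_mem t ω n).1]

theorem abs_E_sub_le (h : X.IsFeasible ℱ S H) (t : ℕ) (ω : Ω) (n : ι) :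
    |X.E (t + 1) ω n - X.E t ω n| ≤ N.energyStep := by
  have h1 := h.outSum_P_le t ω n
  have h2 := outSum_nonneg (fun l => h.P_nonneg t ω l) n
  have h3 := h.e_mem t ω n
  have h4 := N.harvest_le (H t ω) n
  rw [h.E_step, abs_le, energyStep]
  constructor <;> linarith [h3.1, h3.2, le_abs_self N.Pmax, le_abs_self N.hmax, abs_nonneg N.Pmax,
    abs_nonneg N.hmax]

theorem measurable_Q (h : X.IsFeasible ℱ S H) (t : ℕ) (n c : ι) :
    Measurable[ℱ t] fun ω => X.Q t ω n c := by
  induction t generalizing n c with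
  | zero => simp only [h.Q_zero]; exact measurable_const
  | succ t ih =>
    by_cases hnc : n = c
    · subst hnc
      simp only [h.Q_dest]
      exact measurable_const
    · refine Measurable.mono ?_ (ℱ.mono (Nat.le_succ t)) le_rfl
      simp only [h.Q_step_sent t _ hnc]
      exact (ih n c).add (((h.measurable_R t n c).add
        (Finset.measurable_sum _ fun l _ => h.measurable_sent t l c)).sub
        (Finset.measurable_sum _ fun l _ => h.measurable_sent t l c))

theorem measurable_E (h : X.IsFeasible ℱ S H) (t : ℕ) (n : ι) :
    Measurable[ℱ t] fun ω => X.E t ω n := by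
  induction t with
  | zero => simp only [h.E_zero]; exact measurable_const
  | succ t ih =>
    refine Measurable.mono ?_ (ℱ.mono (Nat.le_succ t)) le_rfl
    simp only [h.E_step]
    exact (ih.sub (Finset.measurable_sum _ fun l _ => h.measurable_P t l)).add
      (h.measurable_e t n)

variable {Pr : Measure Ω} [IsProbabilityMeasure Pr]

theorem integrable_R (h : X.IsFeasible ℱ S H) (t : ℕ) (n c : ι) :
    Integrable (fun ω => X.R t ω n c) Pr :=
  integrable_of_abs_le ((h.measurable_R t n c).mono (ℱ.le t) le_rfl) (D := N.Rmax) fun ω => by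
    rw [abs_of_nonneg (h.R_mem t ω n c).1]; exact (h.R_mem t ω n c).2

theorem abs_sent_le (h : X.IsFeasible ℱ S H) (t : ℕ) (ω : Ω) (l : N.links) (c : ι) :
    |X.sent t ω l c| ≤ |N.muMax| := by
  rw [abs_of_nonneg (h.sent_nonneg t ω l c)]
  exact ((h.sent_le t ω l c).trans (h.mu_le t ω l c)).trans (le_abs_self _)

theorem integrable_sent (h : X.IsFeasible ℱ S H) (t : ℕ) (l : N.links) (c : ι) :
    Integrable (fun ω => X.sent t ω l c) Pr :=
  integrable_of_abs_le ((h.measurable_sent t l c).mono (ℱ.le t) le_rfl) fun ω =>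
    h.abs_sent_le t ω l c

theorem abs_P_le (h : X.IsFeasible ℱ S H) (t : ℕ) (ω : Ω) (l : N.links) :
    |X.P t ω l| ≤ |N.Pmax| := by
  rw [abs_of_nonneg (h.P_nonneg t ω l)]
  exact (h.P_le_Pmax t ω l).trans (le_abs_self _)

theorem integrable_P (h : X.IsFeasible ℱ S H) (t : ℕ) (l : N.links) :
    Integrable (fun ω => X.P t ω l) Pr :=
  integrable_of_abs_le ((h.measurable_P t l).mono (ℱ.le t) le_rfl) fun ω => h.abs_P_le t ω l

theorem abs_e_le (h : X.IsFeasible ℱ S H) (t : ℕ) (ω : Ω) (n : ι) :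
    |X.e t ω n| ≤ |N.hmax| := by
  rw [abs_of_nonneg (h.e_mem t ω n).1]
  exact (h.e_mem t ω n).2.trans ((N.harvest_le _ n).trans (le_abs_self _))

theorem integrable_e (h : X.IsFeasible ℱ S H) (t : ℕ) (n : ι) :
    Integrable (fun ω => X.e t ω n) Pr :=
  integrable_of_abs_le ((h.measurable_e t n).mono (ℱ.le t) le_rfl) fun ω => h.abs_e_le t ω n

theorem integrable_Q (h : X.IsFeasible ℱ S H) (t : ℕ) (n c : ι) :
    Integrable (fun ω => X.Q t ω n c) Pr :=
  integrable_of_abs_le ((h.measurable_Q t n c).mono (ℱ.le t) le_rfl) fun ω => by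
    rw [abs_of_nonneg (h.Q_nonneg t ω n c)]
    exact h.Q_le t ω n c

theorem integral_Q_eq (h : X.IsFeasible ℱ S H) (t : ℕ) {n c : ι} (hnc : n ≠ c) :
    ∫ ω, X.Q t ω n c ∂Pr = ∑ τ ∈ Finset.range t, ∫ ω, X.R τ ω n c ∂Pr
      + N.inSum (fun l => ∑ τ ∈ Finset.range t, ∫ ω, X.sent τ ω l c ∂Pr) n
      - N.outSum (fun l => ∑ τ ∈ Finset.range t, ∫ ω, X.sent τ ω l c ∂Pr) n := by
  induction t with
  | zero => simp [h.Q_zero, inSum, outSum]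
  | succ t ih =>
    have hin : Integrable (fun ω => N.inSum (fun l => X.sent t ω l c) n) Pr :=
      integrable_finsetSum _ fun l _ => h.integrable_sent t l c
    have hout : Integrable (fun ω => N.outSum (fun l => X.sent t ω l c) n) Pr :=
      integrable_finsetSum _ fun l _ => h.integrable_sent t l c
    have hRin : Integrable (fun ω => X.R t ω n c + N.inSum (fun l => X.sent t ω l c) n) Pr :=
      (h.integrable_R t n c).add hin
    have hnet : Integrable (fun ω => X.R t ω n c + N.inSum (fun l => X.sent t ω l c) n
        - N.outSum (fun l => X.sent t ω l c) n) Pr := hRin.sub hout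
    have ein : ∫ ω, N.inSum (fun l => X.sent t ω l c) n ∂Pr =
        N.inSum (fun l => ∫ ω, X.sent t ω l c ∂Pr) n :=
      integral_finsetSum _ fun l _ => h.integrable_sent t l c
    have eout : ∫ ω, N.outSum (fun l => X.sent t ω l c) n ∂Pr =
        N.outSum (fun l => ∫ ω, X.sent t ω l c ∂Pr) n :=
      integral_finsetSum _ fun l _ => h.integrable_sent t l c
    simp only [h.Q_step_sent t _ hnc]
    rw [integral_add (h.integrable_Q t n c) hnet, integral_sub hRin hout,
      integral_add (h.integrable_R t n c) hin, ein, eout, ih]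
    simp only [inSum, outSum, Finset.sum_range_succ, Finset.sum_add_distrib]
    ring

theorem integral_E_eq (h : X.IsFeasible ℱ S H) (t : ℕ) (n : ι) :
    ∫ ω, X.E t ω n ∂Pr = ∑ τ ∈ Finset.range t, ∫ ω, X.e τ ω n ∂Pr
      - N.outSum (fun l => ∑ τ ∈ Finset.range t, ∫ ω, X.P τ ω l ∂Pr) n := by
  have hE : ∀ t, Integrable (fun ω => X.E t ω n) Pr := fun t => by
    refine integrable_of_abs_le ((h.measurable_E t n).mono (ℱ.le t) le_rfl)
      (D := t * N.energyStep) fun ω => ?_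
    rw [abs_of_nonneg (h.E_nonneg t ω n)]
    induction t with
    | zero => simp [h.E_zero]
    | succ t ih =>
      have := (abs_le.1 (h.abs_E_sub_le t ω n)).2
      push_cast
      linarith
  induction t with
  | zero => simp [h.E_zero, outSum]
  | succ t ih =>
    have hout : Integrable (fun ω => N.outSum (X.P t ω) n) Pr :=
      integrable_finsetSum _ fun l _ => h.integrable_P t l
    have eout : ∫ ω, N.outSum (X.P t ω) n ∂Pr = N.outSum (fun l => ∫ ω, X.P t ω l ∂Pr) n :=
      integral_finsetSum _ fun l _ => h.integrable_P t l
    have hEo : Integrable (fun ω => X.E t ω n - N.outSum (X.P t ω) n) Pr := (hE t).sub hout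
    simp only [h.E_step]
    rw [integral_add hEo (h.integrable_e t n), integral_sub (hE t) hout, eout, ih]
    simp only [outSum, Finset.sum_range_succ, Finset.sum_add_distrib]
    ring

end Run.IsFeasible

end EnergyNetwork

/-! ### Ultrafilters adapted to stability -/

theorem liminf_le_of_tendsto_ultrafilter {u : ℕ → ℝ} {D x : ℝ} (hu : ∀ t, |u t| ≤ D)
    {𝒰 : Ultrafilter ℕ} (h𝒰 : (𝒰 : Filter ℕ) ≤ atTop) (hx : Tendsto u 𝒰 (𝓝 x)) :
    liminf u atTop ≤ x := by
  refine le_of_forall_lt fun b hb => ?_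
  obtain ⟨b', hb', hb''⟩ := exists_between hb
  have h1 : ∀ᶠ t in atTop, b' < u t := eventually_lt_of_lt_liminf hb''
    (isBoundedUnder_of ⟨-D, fun t => (abs_le.1 (hu t)).1⟩)
  exact hb'.trans_le (ge_of_tendsto hx ((h1.filter_mono h𝒰).mono fun t ht => ht.le))

/-- If the averages of a nonnegative sequence are bounded above, then the sequence is `o(t)` along
some ultrafilter. -/
theorem exists_ultrafilter_tendsto_div {q : ℕ → ℝ} (hq : ∀ t, 0 ≤ q t) {B : ℝ}
    (hB : ∀ᶠ t : ℕ in atTop, (1 / (t : ℝ)) * ∑ τ ∈ Finset.range t, q τ ≤ B) :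
    ∃ 𝒰 : Ultrafilter ℕ, (𝒰 : Filter ℕ) ≤ atTop ∧
      Tendsto (fun t : ℕ => (1 / (t : ℝ)) * q t) 𝒰 (𝓝 0) := by
  set C := |B| + 1 with hC
  have hC0 : 0 < C := by positivity
  -- Were `q > C` from `t₀` on, the average at `t` would be at least `C - C * t₀ / t`, which exceeds
  -- `C - 1 = |B|` once `t > C * t₀`.
  have hfreq : ∃ᶠ t in atTop, q t ≤ C := by
    intro hcon
    obtain ⟨t₀, ht₀⟩ := eventually_atTop.1 hcon
    obtain ⟨t, htB, ht1, ht2⟩ := (hB.and ((eventually_gt_atTop 0).and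
      ((tendsto_natCast_atTop_atTop (R := ℝ)).eventually_gt_atTop (C * t₀)))).exists
    have ht' : (0 : ℝ) < t := by exact_mod_cast ht1
    have h1 : ∑ τ ∈ Finset.range t, (C - if τ < t₀ then C else 0) ≤
        ∑ τ ∈ Finset.range t, q τ := by
      refine Finset.sum_le_sum fun τ _ => ?_
      split_ifs with h
      · simpa using hq τ
      · have := ht₀ τ (not_lt.1 h)
        push Not at this
        linarith
    have h2 : ∑ τ ∈ Finset.range t, (if τ < t₀ then C else 0) ≤ C * t₀ := by
      rw [← Finset.sum_filter, Finset.sum_const, nsmul_eq_mul, mul_comm]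
      refine mul_le_mul_of_nonneg_left ?_ hC0.le
      have : ((Finset.range t).filter fun τ => τ < t₀).card ≤ (Finset.range t₀).card :=
        Finset.card_le_card fun τ hτ => Finset.mem_range.2 (Finset.mem_filter.1 hτ).2
      rw [Finset.card_range] at this
      exact_mod_cast this
    rw [Finset.sum_sub_distrib, Finset.sum_const, Finset.card_range, nsmul_eq_mul] at h1
    rw [one_div, inv_mul_le_iff₀ ht'] at htB
    have := le_abs_self B
    nlinarith
  have hne : (atTop ⊓ 𝓟 {t | q t ≤ C}).NeBot := frequently_mem_iff_neBot.1 hfreq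
  refine ⟨Ultrafilter.of (atTop ⊓ 𝓟 {t | q t ≤ C}), (Ultrafilter.of_le _).trans inf_le_left, ?_⟩
  refine Tendsto.mono_left ?_ (Ultrafilter.of_le _)
  refine tendsto_of_tendsto_of_tendsto_of_le_of_le' tendsto_const_nhds
    ((tendsto_const_div_atTop_nhds_zero_nat C).mono_left inf_le_left)
    (Eventually.of_forall fun t => mul_nonneg (by positivity) (hq t)) ?_
  refine Filter.mem_of_superset (mem_inf_of_right (mem_principal_self _)) fun t ht => ?_
  show 1 / (t : ℝ) * q t ≤ C / t
  rw [one_div, inv_mul_eq_div]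
  exact div_le_div_of_nonneg_right ht (Nat.cast_nonneg t)

/-! ### Stationary plans extracted from stable policies -/

namespace EnergyNetwork

variable {ι 𝒮 ℋ : Type*} [Fintype ι] [DecidableEq ι]

/-- Rates, and conditional average flows, powers and harvested energies given the channel and
energy states, that are balanced in the mean and whose every linear functional is dominated by that
of some feasible power vector. -/
structure IsStationaryPlan [Fintype 𝒮] [Fintype ℋ] (N : EnergyNetwork ι 𝒮 ℋ) (πS : 𝒮 → ℝ)
    (πH : ℋ → ℝ) (R : ι → ι → ℝ) (f : 𝒮 → N.links → ι → ℝ) (p : 𝒮 → N.links → ℝ)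
    (e : ℋ → ι → ℝ) : Prop where
  R_mem : ∀ n c, R n c ∈ Set.Icc 0 N.Rmax
  f_nonneg : ∀ s l c, 0 ≤ f s l c
  f_le : ∀ s l c, f s l c ≤ N.muMax
  p_nonneg : ∀ s l, 0 ≤ p s l
  p_sum_le : ∀ s n, N.outSum (p s) n ≤ N.Pmax
  e_mem : ∀ j n, e j n ∈ Set.Icc 0 (N.harvest j n)
  -- Support-function form of membership in a convex hull. The bound `w ≤ W` accounts for the
  -- commodities sharing the rate of a link.
  dominated : ∀ s (w : N.links → ι → ℝ) (W y : N.links → ℝ) (M : ℝ), (∀ l c, w l c ≤ W l) →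
    (∀ l, 0 ≤ W l) → (∀ P ∈ N.powerSet s, ∑ l, W l * N.rate s P l + ∑ l, y l * P l ≤ M) →
    ∑ l, ∑ c, w l c * f s l c + ∑ l, y l * p s l ≤ M
  -- An inequality suffices because it will be multiplied by nonnegative backlogs; the energy
  -- balance has to be an equality, as `E - θ` may have either sign.
  flow : ∀ n c, n ≠ c →
    R n c + ∑ s, πS s * (N.inSum (fun l => f s l c) n - N.outSum (fun l => f s l c) n) ≤ 0
  energy : ∀ n, ∑ j, πH j * e j n = ∑ s, πS s * N.outSum (p s) n

variable {N : EnergyNetwork ι 𝒮 ℋ}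

theorem Utot_mono {r r' : ι → ι → ℝ} (hr : ∀ n c, 0 ≤ r n c) (h : ∀ n c, r n c ≤ r' n c) :
    N.Utot r ≤ N.Utot r' :=
  Finset.sum_le_sum fun n _ => Finset.sum_le_sum fun c _ =>
    N.U_mono n c (hr n c) ((hr n c).trans (h n c)) (h n c)

variable {Ω : Type*} {m : MeasurableSpace Ω} {Pr : Measure Ω}
  [IsProbabilityMeasure Pr] {ℱ : Filtration ℕ m} {S : ℕ → Ω → 𝒮} {H : ℕ → Ω → ℋ} {X : N.Run Ω}

theorem Run.avgRate_mem (h : X.IsFeasible ℱ S H) (t : ℕ) (n c : ι) :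
    X.avgRate Pr t n c ∈ Set.Icc 0 N.Rmax := by
  have h0 : ∀ τ, 0 ≤ ∫ ω, X.R τ ω n c ∂Pr := fun τ =>
    integral_nonneg fun ω => (h.R_mem τ ω n c).1
  have hb : ∀ τ, |∫ ω, X.R τ ω n c ∂Pr| ≤ N.Rmax := fun τ => abs_integral_le_of_abs_le fun ω => by
    rw [abs_of_nonneg (h.R_mem τ ω n c).1]; exact (h.R_mem τ ω n c).2
  exact ⟨mul_nonneg (by positivity) (Finset.sum_nonneg fun τ _ => h0 τ),
    (le_abs_self _).trans (abs_avg_le hb t)⟩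

theorem Run.abs_avgRate_le (h : X.IsFeasible ℱ S H) (t : ℕ) (n c : ι) :
    |X.avgRate Pr t n c| ≤ N.Rmax := by
  rw [abs_of_nonneg (Run.avgRate_mem h t n c).1]
  exact (Run.avgRate_mem h t n c).2

theorem Run.rbar_nonneg (h : X.IsFeasible ℱ S H) (n c : ι) : 0 ≤ X.rbar Pr n c :=
  le_liminf_of_le (isCoboundedUnder_ge_of_le _ (x := N.Rmax)
    fun t => (Run.avgRate_mem h t n c).2)
    (Eventually.of_forall fun t => (Run.avgRate_mem h t n c).1)

theorem exists_isStationaryPlan [Fintype 𝒮] [DecidableEq 𝒮] [Fintype ℋ] [DecidableEq ℋ]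
    {KS : Matrix 𝒮 𝒮 ℝ} {KH : Matrix ℋ ℋ ℝ} {πS : 𝒮 → ℝ} {πH : ℋ → ℝ} {FS : 𝒮 → 𝒮 → ℝ} {FH : ℋ → ℋ → ℝ}
    (hS : IsMarkovChainFor Pr ℱ KS S) (hH : IsMarkovChainFor Pr ℱ KH H)
    (hπS : ∀ s, 0 < πS s) (hπH : ∀ j, 0 < πH j)
    (hFS : ∀ s x, FS s x - ∑ y, KS x y * FS s y = (if x = s then 1 else 0) - πS s)
    (hFH : ∀ s x, FH s x - ∑ y, KH x y * FH s y = (if x = s then 1 else 0) - πH s)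
    (h : X.IsFeasible ℱ S H) (hst : X.IsStable Pr) (hfin : X.HasFiniteStorage) :
    ∃ R f p e, IsStationaryPlan N πS πH R f p e ∧ N.Utot (X.rbar Pr) ≤ N.Utot R := by
  obtain ⟨B, hB⟩ := hst
  -- Stability bounds only averaged backlogs, so the ultrafilter is chosen to make backlog over time
  -- vanish; every later limit is taken along it.
  obtain ⟨𝒰, h𝒰, hQ𝒰⟩ := exists_ultrafilter_tendsto_div 
    (q := fun τ => ∑ n, ∑ c, ∫ ω, X.Q τ ω n c ∂Pr)
    (fun t => Finset.sum_nonneg fun n _ => Finset.sum_nonneg fun c _ =>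
      integral_nonneg fun ω => h.Q_nonneg t ω n c) hB
  have hQlim : ∀ n c, Tendsto (fun t : ℕ => (1 / (t : ℝ)) * ∫ ω, X.Q t ω n c ∂Pr) 𝒰 (𝓝 0) := by
    intro n c
    have h0 : ∀ t n c, 0 ≤ ∫ ω, X.Q t ω n c ∂Pr := fun t n c =>
      integral_nonneg fun ω => h.Q_nonneg t ω n c
    refine squeeze_zero (fun t => mul_nonneg (by positivity) (h0 t n c)) (fun t => ?_) hQ𝒰
    refine mul_le_mul_of_nonneg_left ?_ (by positivity)
    exact (Finset.single_le_sum (f := fun c => ∫ ω, X.Q t ω n c ∂Pr) (fun c _ => h0 t n c)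
      (Finset.mem_univ c)).trans (Finset.single_le_sum (f := fun n => ∑ c, ∫ ω, X.Q t ω n c ∂Pr)
      (fun n _ => Finset.sum_nonneg fun c _ => h0 t n c) (Finset.mem_univ n))
  obtain ⟨BE, hBE⟩ := hfin
  have hElim : ∀ n, Tendsto (fun t : ℕ => (1 / (t : ℝ)) * ∫ ω, X.E t ω n ∂Pr) 𝒰 (𝓝 0) := by
    intro n
    refine Tendsto.mono_left ?_ h𝒰
    refine squeeze_zero (fun t => mul_nonneg (by positivity)
      (integral_nonneg fun ω => h.E_nonneg t ω n)) (fun t => ?_)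
      (tendsto_const_div_atTop_nhds_zero_nat BE)
    rw [one_div, inv_mul_eq_div]
    refine div_le_div_of_nonneg_right ((le_abs_self _).trans
      (abs_integral_le_of_abs_le fun ω => ?_)) (Nat.cast_nonneg t)
    rw [abs_of_nonneg (h.E_nonneg t ω n)]
    exact hBE t ω n
  choose R hR using fun n c => exists_tendsto_ultrafilter 𝒰
    (Run.abs_avgRate_le (Pr := Pr) h · n c)
  -- Flows and powers form a single family because domination bounds them jointly.
  obtain ⟨A, hA, hAdom⟩ := hS.exists_conditional_average hπS hFS h𝒰
    (a := fun t ω (i : (N.links × ι) ⊕ N.links) =>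
      Sum.elim (fun x => X.sent t ω x.1 x.2) (fun l => X.P t ω l) i)
    (by
      rintro t (⟨l, c⟩ | l)
      · exact (h.measurable_sent t l c).mono (ℱ.le t) le_rfl
      · exact (h.measurable_P t l).mono (ℱ.le t) le_rfl)
    (D := |N.muMax| + |N.Pmax|)
    (by
      rintro t ω (⟨l, c⟩ | l)
      · exact (h.abs_sent_le t ω l c).trans (le_add_of_nonneg_right (abs_nonneg _))
      · exact (h.abs_P_le t ω l).trans (le_add_of_nonneg_left (abs_nonneg _)))
  obtain ⟨e, he, hedom⟩ := hH.exists_conditional_average hπH hFH h𝒰 (a := X.e)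
    (fun t n => (h.measurable_e t n).mono (ℱ.le t) le_rfl) (D := |N.hmax|) h.abs_e_le
  have hAsingle : ∀ s i (k M : ℝ), (∀ τ ω, S τ ω = s → k * Sum.elim
      (fun x : N.links × ι => X.sent τ ω x.1 x.2) (fun l => X.P τ ω l) i ≤ M) → k * A s i ≤ M := by
    intro s i k M hM
    have := hAdom s (fun i' => if i' = i then k else 0) M fun τ ω hs => by
      simpa using hM τ ω hs
    simpa using this
  have hesingle : ∀ j n (k M : ℝ), (∀ τ ω, H τ ω = j → k * X.e τ ω n ≤ M) → k * e j n ≤ M := by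
    intro j n k M hM
    have := hedom j (fun i' => if i' = n then k else 0) M fun τ ω hs => by
      simpa using hM τ ω hs
    simpa using this
  have hAdom' : ∀ s (w : N.links → ι → ℝ) (y : N.links → ℝ) M, (∀ τ ω, S τ ω = s →
      ∑ l, ∑ c, w l c * X.sent τ ω l c + ∑ l, y l * X.P τ ω l ≤ M) →
      ∑ l, ∑ c, w l c * A s (.inl (l, c)) + ∑ l, y l * A s (.inr l) ≤ M := by
    intro s w y M hM
    have := hAdom s (Sum.elim (fun x => w x.1 x.2) y) M fun τ ω hs => by
      simpa [Fintype.sum_sum_type, Fintype.sum_prod_type] using hM τ ω hs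
    simpa [Fintype.sum_sum_type, Fintype.sum_prod_type] using this
  refine ⟨R, fun s l c => A s (.inl (l, c)), fun s l => A s (.inr l), e, ⟨?_, ?_, ?_, ?_, ?_, ?_,
    ?_, ?_, ?_⟩, ?_⟩
  · intro n c
    exact ⟨ge_of_tendsto' (hR n c) fun t => (Run.avgRate_mem h t n c).1,
      le_of_tendsto' (hR n c) fun t => (Run.avgRate_mem h t n c).2⟩
  · intro s l c
    have := hAsingle s (.inl (l, c)) (-1) 0 fun τ ω _ => by
      simpa using h.sent_nonneg τ ω l c
    linarith
  · intro s l c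
    have := hAsingle s (.inl (l, c)) 1 N.muMax fun τ ω _ => by
      simpa using (h.sent_le τ ω l c).trans (h.mu_le τ ω l c)
    linarith
  · intro s l
    have := hAsingle s (.inr l) (-1) 0 fun τ ω _ => by
      simpa using h.P_nonneg τ ω l
    linarith
  · intro s n
    have := hAdom' s (fun _ _ => 0) (fun l => if l.1.1 = n then 1 else 0) N.Pmax fun τ ω _ => by
      simpa [outSum, Finset.sum_filter] using h.outSum_P_le τ ω n
    simpa [outSum, Finset.sum_filter] using this
  · intro j n
    have h1 := hesingle j n (-1) 0 fun τ ω _ => by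
      simpa using (h.e_mem τ ω n).1
    have h2 := hesingle j n 1 (N.harvest j n) fun τ ω hj => by
      simpa [hj] using (h.e_mem τ ω n).2
    exact ⟨by linarith, by linarith⟩
  · intro s w W y M hwW hW hM
    refine hAdom' s w y M fun τ ω hs => le_trans ?_ (hM _ (hs ▸ h.P_mem τ ω))
    gcongr with l
    calc ∑ c, w l c * X.sent τ ω l c ≤ ∑ c, W l * X.mu τ ω l c := by
          refine Finset.sum_le_sum fun c _ => ?_
          exact (mul_le_mul_of_nonneg_right (hwW l c) (h.sent_nonneg τ ω l c)).trans
            (mul_le_mul_of_nonneg_left (h.sent_le τ ω l c) (hW l))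
      _ = W l * ∑ c, X.mu τ ω l c := (Finset.mul_sum ..).symm
      _ ≤ W l * N.rate s (X.P τ ω) l :=
          mul_le_mul_of_nonneg_left (hs ▸ h.mu_sum_le τ ω l) (hW l)
  · intro n c hnc
    have hlim : Tendsto (fun t : ℕ => (1 / (t : ℝ)) * ∫ ω, X.Q t ω n c ∂Pr) 𝒰
        (𝓝 (R n c + N.inSum (fun l => ∑ s, πS s * A s (.inl (l, c))) n
          - N.outSum (fun l => ∑ s, πS s * A s (.inl (l, c))) n)) := by
      have h1 : Tendsto (fun t : ℕ => X.avgRate Pr t n c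
          + N.inSum (fun l => (1 / (t : ℝ)) * ∑ τ ∈ Finset.range t, ∫ ω, X.sent τ ω l c ∂Pr) n
          - N.outSum (fun l => (1 / (t : ℝ)) * ∑ τ ∈ Finset.range t, ∫ ω, X.sent τ ω l c ∂Pr) n) 𝒰
          (𝓝 (R n c + N.inSum (fun l => ∑ s, πS s * A s (.inl (l, c))) n
          - N.outSum (fun l => ∑ s, πS s * A s (.inl (l, c))) n)) :=
        ((hR n c).add (tendsto_finsetSum _ fun l _ => hA (.inl (l, c)))).sub
          (tendsto_finsetSum _ fun l _ => hA (.inl (l, c)))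
      refine h1.congr fun t => ?_
      rw [h.integral_Q_eq t hnc, Run.avgRate, mul_sub, mul_add]
      simp only [inSum, outSum, Finset.mul_sum]
    have := tendsto_nhds_unique hlim (hQlim n c)
    have e1 : ∑ s, πS s * (N.inSum (fun l => A s (.inl (l, c))) n
        - N.outSum (fun l => A s (.inl (l, c))) n) =
        N.inSum (fun l => ∑ s, πS s * A s (.inl (l, c))) n
          - N.outSum (fun l => ∑ s, πS s * A s (.inl (l, c))) n := by
      simp only [mul_sub, Finset.sum_sub_distrib, inSum, outSum, Finset.mul_sum]
      congr 1 <;> exact Finset.sum_comm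
    rw [e1]
    linarith
  · intro n
    have hlim : Tendsto (fun t : ℕ => (1 / (t : ℝ)) * ∫ ω, X.E t ω n ∂Pr) 𝒰
        (𝓝 (∑ j, πH j * e j n - N.outSum (fun l => ∑ s, πS s * A s (.inr l)) n)) := by
      have h1 : Tendsto (fun t : ℕ => (1 / (t : ℝ)) * ∑ τ ∈ Finset.range t, ∫ ω, X.e τ ω n ∂Pr
          - N.outSum (fun l => (1 / (t : ℝ)) * ∑ τ ∈ Finset.range t, ∫ ω, X.P τ ω l ∂Pr) n) 𝒰
          (𝓝 (∑ j, πH j * e j n - N.outSum (fun l => ∑ s, πS s * A s (.inr l)) n)) :=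
        (he n).sub (tendsto_finsetSum _ fun l _ => hA (.inr l))
      refine h1.congr fun t => ?_
      rw [h.integral_E_eq t n, mul_sub]
      simp only [outSum, Finset.mul_sum]
    have := tendsto_nhds_unique hlim (hElim n)
    have e1 : ∑ s, πS s * N.outSum (fun l => A s (.inr l)) n =
        N.outSum (fun l => ∑ s, πS s * A s (.inr l)) n := by
      simp only [outSum, Finset.mul_sum]
      exact Finset.sum_comm
    rw [e1]
    linarith
  · exact Utot_mono (Run.rbar_nonneg h) fun n c =>
      liminf_le_of_tendsto_ultrafilter (Run.abs_avgRate_le h · n c) h𝒰 (hR n c)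

end EnergyNetwork

namespace EnergyNetwork

variable {ι 𝒮 ℋ : Type*} [Fintype ι] [DecidableEq ι] (N : EnergyNetwork ι 𝒮 ℋ)

/-! ### Elementary bounds -/

theorem β_nonneg : 0 ≤ N.β :=
  Real.iSup_nonneg fun p => (N.U_mono p.1 p.2).derivWithin_nonneg

theorem U_nonneg (n c : ι) {r : ℝ} (hr : 0 ≤ r) : 0 ≤ N.U n c r := by
  rw [← N.U_zero n c]
  exact N.U_mono n c Set.self_mem_Ici hr hr

/-- By concavity the chord from `0` has slope at most the derivative at `0`. -/
theorem U_le_β_mul (n c : ι) {r : ℝ} (hr : 0 ≤ r) : N.U n c r ≤ N.β * r := by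
  rcases hr.eq_or_lt with rfl | hr
  · simp [N.U_zero]
  have h1 := (N.U_strictConcave n c).concaveOn.slope_le_derivWithin Set.self_mem_Ici hr.le hr
    ((N.U_contDiff n c).differentiableOn (by norm_num) 0 Set.self_mem_Ici)
  have h2 : derivWithin (N.U n c) (Set.Ici 0) 0 ≤ N.β :=
    le_ciSup (f := fun p : ι × ι => derivWithin (N.U p.1 p.2) (Set.Ici 0) 0)
      (Set.finite_range _).bddAbove (n, c)
  rw [slope_def_field, N.U_zero, sub_zero, sub_zero] at h1
  exact (div_le_iff₀ hr).1 (h1.trans h2)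

theorem muMax_nonneg [Nonempty 𝒮] (l : N.links) : 0 ≤ N.muMax := by
  obtain ⟨s⟩ := ‹Nonempty 𝒮›
  obtain ⟨P, hP⟩ := N.powerSet_nonempty s
  exact (N.rate_nonneg s P hP l).trans (N.rate_le s P hP l)

theorem Pmax_nonneg [Nonempty 𝒮] (n : ι) : 0 ≤ N.Pmax := by
  obtain ⟨s⟩ := ‹Nonempty 𝒮›
  obtain ⟨P, hP⟩ := N.powerSet_nonempty s
  exact (outSum_nonneg (N.power_nonneg s P hP) n).trans (N.power_sum_le s P hP n)

variable {N}

theorem dmax_eq_zero [IsEmpty N.links] : N.dmax = 0 :=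
  Nat.le_zero.1 (Finset.sup_le fun n _ => by simp)

theorem inSum_le_dmax_mul [Nonempty 𝒮] {x : N.links → ℝ} (hx : ∀ l, x l ≤ N.muMax) (n : ι) :
    N.inSum x n ≤ N.dmax * N.muMax := by
  -- Without links the sign of `muMax` is unknown, but then `dmax` is zero.
  cases isEmpty_or_nonempty N.links with
  | inl h => simp [inSum, dmax_eq_zero]
  | inr h =>
    obtain ⟨l⟩ := h
    refine (Finset.sum_le_sum fun l _ => hx l).trans ?_
    rw [Finset.sum_const, nsmul_eq_mul]
    refine mul_le_mul_of_nonneg_right ?_ (N.muMax_nonneg l)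
    exact_mod_cast Finset.le_sup
      (f := fun n : ι => (Finset.univ.filter fun l : N.links => l.1.2 = n).card) (Finset.mem_univ n)

variable (N)

theorem Rmax_le_γ [Nonempty 𝒮] : N.Rmax ≤ N.γ := by
  unfold γ
  cases isEmpty_or_nonempty N.links with
  | inl h => simp [dmax_eq_zero]
  | inr h =>
    obtain ⟨l⟩ := h
    have := mul_nonneg (Nat.cast_nonneg (α := ℝ) N.dmax) (N.muMax_nonneg l)
    linarith

theorem γ_nonneg [Nonempty 𝒮] : 0 ≤ N.γ := N.Rmax_nonneg.trans N.Rmax_le_γ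

variable {N} {Ω : Type*} {m : MeasurableSpace Ω} {X : N.Run Ω} {V : ℝ} {ℱ : Filtration ℕ m}
  {S : ℕ → Ω → 𝒮} {H : ℕ → Ω → ℋ}

theorem Run.weight_nonneg (t : ℕ) (ω : Ω) (l : N.links) (c : ι) : 0 ≤ X.weight t ω l c :=
  le_max_right _ _

theorem Run.weight_le_linkWeight (t : ℕ) (ω : Ω) (l : N.links) (c : ι) :
    X.weight t ω l c ≤ X.linkWeight t ω l :=
  le_ciSup (f := fun c => X.weight t ω l c) (Set.finite_range _).bddAbove c

theorem Run.linkWeight_nonneg (t : ℕ) (ω : Ω) (l : N.links) : 0 ≤ X.linkWeight t ω l :=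
  Real.iSup_nonneg fun c => Run.weight_nonneg t ω l c

theorem Run.G_eq (t : ℕ) (ω : Ω) (s : 𝒮) (P : N.links → ℝ) : X.G V t ω s P =
    ∑ l, X.linkWeight t ω l * N.rate s P l + ∑ l : N.links, (X.E t ω l.1.1 - N.θ V) * P l := by
  have h1 := sum_mul_outSum (fun _ => 1) (fun l => N.rate s P l * X.linkWeight t ω l)
  have h2 := sum_mul_outSum (fun n => X.E t ω n - N.θ V) P
  simp only [one_mul] at h1
  rw [Run.G, Finset.sum_add_distrib, h1, h2]
  simp only [mul_comm]

/-! ### The algorithm -/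

namespace Run.IsESA

/-- Induction on time. If data of commodity `c` may enter, the queue is below that of some sender by
more than `γ`, the largest possible arrival. If not, admission adds at most `Rmax` to a queue below
`β V`, and nothing to a larger one, where `V U(r) - Q r < 0` for `r > 0`. -/
theorem Q_le (h : X.IsESA V ℱ S H) (hV : 1 ≤ V) (t : ℕ) (ω : Ω) (n c : ι) :
    X.Q t ω n c ≤ N.β * V + N.Rmax := by
  have hne : Nonempty 𝒮 := ⟨S 0 ω⟩
  have hbase : 0 ≤ N.β * V + N.Rmax :=
    add_nonneg (mul_nonneg N.β_nonneg (by linarith)) N.Rmax_nonneg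
  induction t generalizing n c with
  | zero => rw [h.feasible.Q_zero]; exact hbase
  | succ t ih =>
    by_cases hnc : n = c
    · subst hnc
      rw [h.feasible.Q_dest]; exact hbase
    have hQ := h.feasible.Q_nonneg t ω n c
    have hmax : max (X.Q t ω n c - N.outSum (fun l => X.mu t ω l c) n) 0 ≤ X.Q t ω n c :=
      max_le (by linarith [outSum_nonneg (fun l => h.feasible.mu_nonneg t ω l c) n]) hQ
    have hR := h.feasible.R_mem t ω n c
    rw [h.feasible.Q_step t ω n c hnc]
    by_cases hin : ∃ l : N.links, l.1.2 = n ∧ X.mu t ω l c ≠ 0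
    · obtain ⟨l, rfl, hl⟩ := hin
      obtain ⟨c', -, hc', h0⟩ := h.routing t ω l
      have hcc : c = c' := by
        by_contra hne
        exact hl (h0 c hne)
      subst hcc
      have hw : 0 < X.weight t ω l c := by
        by_contra hw
        rw [if_neg hw] at hc'
        exact hl hc'
      have hw' : 0 < X.Q t ω l.1.1 c - X.Q t ω l.1.2 c - N.γ := by
        rcases lt_max_iff.1 hw with h1 | h1
        · exact h1
        · exact absurd h1 (lt_irrefl _)
      have h1 := inSum_le_dmax_mul (fun l => (h.feasible.sent_le t ω l c).trans
        (h.feasible.mu_le t ω l c)) l.1.2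
      have h2 := ih l.1.1 c
      have h3 : N.γ = N.Rmax + N.dmax * N.muMax := rfl
      linarith [hR.2]
    · push Not at hin
      have h1 : N.inSum (fun l => X.sent t ω l c) n ≤ 0 :=
        Finset.sum_nonpos fun l hl => (h.feasible.sent_le t ω l c).trans
          (hin l (Finset.mem_filter.1 hl).2).le
      rcases le_or_gt (X.Q t ω n c) (N.β * V) with hb | hb
      · linarith [hR.2]
      · have h2 : V * N.U n c 0 - X.Q t ω n c * 0 ≤
            V * N.U n c (X.R t ω n c) - X.Q t ω n c * X.R t ω n c :=
          h.admission t ω n c ⟨le_rfl, N.Rmax_nonneg⟩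
        have h3 := mul_le_mul_of_nonneg_left (N.U_le_β_mul n c hR.1) (by linarith : 0 ≤ V)
        rw [N.U_zero] at h2
        have h4 : X.R t ω n c ≤ 0 := by
          by_contra hc
          push Not at hc
          nlinarith
        linarith [ih n c]

theorem E_le (h : X.IsESA V ℱ S H) (hV : 1 ≤ V) (t : ℕ) (ω : Ω) (n : ι) :
    X.E t ω n ≤ N.θ V + N.hmax := by
  have hne : Nonempty 𝒮 := ⟨S 0 ω⟩
  induction t with
  | zero =>
    rw [h.feasible.E_zero]
    have h1 := (N.harvest_nonneg (H 0 ω) n).trans (N.harvest_le (H 0 ω) n)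
    have h2 := N.Pmax_nonneg n
    have h3 := mul_nonneg (mul_nonneg N.δ_pos.le N.β_nonneg) (by linarith : 0 ≤ V)
    unfold θ
    linarith
  | succ t ih =>
    have h1 := outSum_nonneg (fun l => h.feasible.P_nonneg t ω l) n
    have h2 := N.harvest_le (H t ω) n
    rw [h.feasible.E_step, h.harvesting]
    split_ifs with hE
    · linarith
    · linarith

/-- Subtracting `γ ≥ Rmax` removes the excess of the backlog bound over `β V`. This fixes the scale
of `θ`. -/
theorem linkWeight_le (h : X.IsESA V ℱ S H) (hV : 1 ≤ V) (t : ℕ) (ω : Ω) (l : N.links) :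
    X.linkWeight t ω l ≤ N.β * V := by
  have hne : Nonempty 𝒮 := ⟨S 0 ω⟩
  obtain ⟨c', hc', -⟩ := h.routing t ω l
  rw [← hc']
  refine max_le ?_ (mul_nonneg N.β_nonneg (by linarith))
  linarith [h.Q_le hV t ω l.1.1 c', h.feasible.Q_nonneg t ω l.1.2 c', N.Rmax_le_γ]

/-- Switching off a link out of a node with little energy does not decrease the objective. -/
theorem G_le_update (h : X.IsESA V ℱ S H) (hV : 1 ≤ V) (t : ℕ) (ω : Ω) {s : 𝒮} {P : N.links → ℝ}
    (hP : P ∈ N.powerSet s) {l : N.links} (hl : X.E t ω l.1.1 < N.Pmax) :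
    X.G V t ω s P ≤ X.G V t ω s (Function.update P l 0) := by
  rw [Run.G_eq, Run.G_eq, ← Finset.sum_add_distrib, ← Finset.sum_add_distrib]
  refine Finset.sum_le_sum fun l' _ => ?_
  have hW := Run.linkWeight_nonneg (X := X) t ω l'
  by_cases hl' : l' = l
  · subst hl'
    have h1 := mul_le_mul_of_nonneg_left (N.rate_linear s P hP l') hW
    have h2 := h.linkWeight_le hV t ω l'
    have h3 : N.θ V = N.δ * N.β * V + N.Pmax := rfl
    have h4 := mul_le_mul_of_nonneg_left h2 N.δ_pos.le
    -- As `E < Pmax`, `θ - E` exceeds `δ β V`, which is at least `δ` times the link weight: the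
    -- energy saved outweighs the rate lost.
    have h5 : 0 ≤ (N.θ V - X.E t ω l'.1.1 - N.δ * X.linkWeight t ω l') * P l' :=
      mul_nonneg (by linarith) (N.power_nonneg s P hP l')
    rw [Function.update_self]
    linarith
  · rw [Function.update_of_ne hl']
    have h1 := mul_le_mul_of_nonneg_left (N.rate_interference s P hP l l' hl') hW
    linarith

/-- The energy availability constraint is never binding. -/
theorem G_le (h : X.IsESA V ℱ S H) (hV : 1 ≤ V) (t : ℕ) (ω : Ω) {P : N.links → ℝ}
    (hP : P ∈ N.powerSet (S t ω)) : X.G V t ω (S t ω) P ≤ X.G V t ω (S t ω) (X.P t ω) := by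
  have key : ∀ Z : Finset N.links, (∀ l ∈ Z, X.E t ω l.1.1 < N.Pmax) →
      ∃ P' ∈ N.powerSet (S t ω), (∀ l ∈ Z, P' l = 0) ∧
        X.G V t ω (S t ω) P ≤ X.G V t ω (S t ω) P' := by
    intro Z
    induction Z using Finset.induction_on with
    | empty => exact fun _ => ⟨P, hP, by simp, le_rfl⟩
    | insert l Z _ ih =>
      intro hZ
      obtain ⟨P', hP', h0, hG⟩ := ih fun l' hl' => hZ l' (Finset.mem_insert_of_mem hl')
      refine ⟨Function.update P' l 0, N.power_zeroing _ _ hP' l, fun l' hl' => ?_,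
        hG.trans (h.G_le_update hV t ω hP' (hZ l (Finset.mem_insert_self _ _)))⟩
      by_cases hll : l' = l
      · subst hll; simp
      · rw [Function.update_of_ne hll]
        exact h0 l' ((Finset.mem_insert.1 hl').resolve_left hll)
  obtain ⟨P', hP', h0, hG⟩ := key (Finset.univ.filter fun l => X.E t ω l.1.1 < N.Pmax)
    fun l hl => (Finset.mem_filter.1 hl).2
  -- The modified vector respects energy availability: nodes with less than `Pmax` use nothing, the
  -- others can afford any feasible power.
  refine hG.trans (h.power t ω ⟨hP', fun n => ?_⟩)
  rcases lt_or_ge (X.E t ω n) N.Pmax with hn | hn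
  · have : N.outSum P' n = 0 := Finset.sum_eq_zero fun l hl => h0 l
      (Finset.mem_filter.2 ⟨Finset.mem_univ _, by rwa [(Finset.mem_filter.1 hl).2]⟩)
    rw [this]
    exact h.feasible.E_nonneg t ω n
  · exact (N.power_sum_le _ _ hP' n).trans hn

end Run.IsESA

/-! ### The drift -/

/-- The quadratic Lyapunov function. -/
def Run.lyapunov (X : N.Run Ω) (V : ℝ) (t : ℕ) (ω : Ω) : ℝ :=
  (1 / 2) * (∑ n, ∑ c, X.Q t ω n c ^ 2 + ∑ n, (X.E t ω n - N.θ V) ^ 2)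

theorem Run.lyapunov_nonneg (t : ℕ) (ω : Ω) : 0 ≤ X.lyapunov V t ω := by
  unfold Run.lyapunov; positivity

variable (N) in
/-- A bound on the second-order terms of the drift. -/
def driftConst : ℝ :=
  ∑ _n : ι, ∑ _c : ι, N.queueStep ^ 2 + ∑ _n : ι, N.energyStep ^ 2

/-- Expand the squares, dropping the positive part. Replacing the data received by the allocated
inflow only enlarges the bound, as backlogs are nonnegative; the two halved squares left are each at
most `queueStep ^ 2 / 2`. -/
theorem Run.IsFeasible.lyapunov_drift (h : X.IsFeasible ℱ S H) (t : ℕ) (ω : Ω) :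
    X.lyapunov V (t + 1) ω - X.lyapunov V t ω ≤ N.driftConst
      + ∑ n, ∑ c, X.Q t ω n c * (X.R t ω n c + N.inSum (fun l => X.mu t ω l c) n
          - N.outSum (fun l => X.mu t ω l c) n)
      + ∑ n, (X.E t ω n - N.θ V) * (X.e t ω n - N.outSum (X.P t ω) n) := by
  have hq : ∀ n c, (1 / 2) * X.Q (t + 1) ω n c ^ 2 - (1 / 2) * X.Q t ω n c ^ 2 ≤ N.queueStep ^ 2 +
      X.Q t ω n c * (X.R t ω n c + N.inSum (fun l => X.mu t ω l c) n
          - N.outSum (fun l => X.mu t ω l c) n) := by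
    intro n c
    by_cases hnc : n = c
    · subst hnc
      simp only [h.Q_dest]
      nlinarith [sq_nonneg N.queueStep]
    have h0 := h.Q_nonneg t ω n c
    have h1 := inSum_nonneg (fun l => h.sent_nonneg t ω l c) n
    have h2 := inSum_le_flowBound (fun l => (h.sent_le t ω l c).trans (h.mu_le t ω l c)) n
    have h2' := inSum_mono (fun l => h.sent_le t ω l c) n
    have h3 := outSum_nonneg (fun l => h.mu_nonneg t ω l c) n
    have h4 := outSum_le_flowBound (fun l => h.mu_le t ω l c) n
    have h5 := h.R_mem t ω n c
    have h7 := N.Rmax_nonneg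
    rw [h.Q_step t ω n c hnc]
    set q := X.Q t ω n c
    set b := N.outSum (fun l => X.mu t ω l c) n
    set a := N.inSum (fun l => X.sent t ω l c) n
    set a' := N.inSum (fun l => X.mu t ω l c) n
    set r := X.R t ω n c
    have hb : b ^ 2 ≤ N.queueStep ^ 2 := pow_le_pow_left₀ h3 (by unfold queueStep; linarith) 2
    have ha : (a + r) ^ 2 ≤ N.queueStep ^ 2 :=
      pow_le_pow_left₀ (by linarith [h5.1]) (by unfold queueStep; linarith [h5.2]) 2
    have hM1 : max (q - b) 0 ^ 2 ≤ (q - b) ^ 2 := by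
      rcases le_total (q - b) 0 with hl | hl
      · rw [max_eq_right hl]; nlinarith [sq_nonneg (q - b)]
      · rw [max_eq_left hl]
    have hM2 : max (q - b) 0 ≤ q := max_le (by linarith) h0
    have hM3 : max (q - b) 0 * (a + r) ≤ q * (a + r) :=
      mul_le_mul_of_nonneg_right hM2 (by linarith [h5.1])
    have hM4 : q * a ≤ q * a' := mul_le_mul_of_nonneg_left h2' h0
    nlinarith
  have he : ∀ n, (1 / 2) * (X.E (t + 1) ω n - N.θ V) ^ 2 - (1 / 2) * (X.E t ω n - N.θ V) ^ 2 ≤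
      N.energyStep ^ 2 + (X.E t ω n - N.θ V) * (X.e t ω n - N.outSum (X.P t ω) n) := by
    intro n
    have h1 := h.abs_E_sub_le t ω n
    rw [h.E_step] at h1 ⊢
    have h2 := sq_le_sq' (abs_le.1 h1).1 (abs_le.1 h1).2
    nlinarith
  have hsum := add_le_add
    (Finset.sum_le_sum fun n (_ : n ∈ Finset.univ) =>
      Finset.sum_le_sum fun c (_ : c ∈ Finset.univ) => hq n c)
    (Finset.sum_le_sum fun n (_ : n ∈ Finset.univ) => he n)
  simp only [Finset.sum_add_distrib, Finset.sum_sub_distrib, ← Finset.mul_sum] at hsum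
  simp only [Run.lyapunov, driftConst]
  linarith

variable (N) in
/-- The loss caused by the term `γ` in the weights. -/
def weightConst : ℝ := ∑ _l : N.links, ∑ _c : ι, N.γ * N.muMax

/-- Summation by parts on the graph; it turns backlogs at nodes into the differential backlogs that
the weights measure. -/
theorem sum_mul_inSum_sub_outSum (z : ι → ι → ℝ) (x : N.links → ι → ℝ) :
    ∑ n, ∑ c, z n c * (N.inSum (fun l => x l c) n - N.outSum (fun l => x l c) n) =
      -∑ l : N.links, ∑ c, (z l.1.1 c - z l.1.2 c) * x l c := by
  rw [Finset.sum_comm]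
  simp only [mul_sub, Finset.sum_sub_distrib]
  have h1 : ∀ c, ∑ n, z n c * N.inSum (fun l => x l c) n = ∑ l : N.links, z l.1.2 c * x l c :=
    fun c => sum_mul_inSum (fun n => z n c) fun l => x l c
  have h2 : ∀ c, ∑ n, z n c * N.outSum (fun l => x l c) n = ∑ l : N.links, z l.1.1 c * x l c :=
    fun c => sum_mul_outSum (fun n => z n c) fun l => x l c
  have hcomm : ∀ y : N.links → ι → ℝ, ∑ c, ∑ l, y l c = ∑ l, ∑ c, y l c := fun y =>
    Finset.sum_comm
  simp only [h1, h2]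
  rw [hcomm fun l c => z l.1.2 c * x l c, hcomm fun l c => z l.1.1 c * x l c]
  simp only [sub_mul, Finset.sum_sub_distrib]
  ring

/-- Admission, harvesting and power allocation each optimize their own share of the drift bound, so
each may be replaced by the plan. The plan need not respect energy availability, which is harmless
because the constraint never binds. -/
theorem Run.IsESA.drift_le [Fintype 𝒮] [Fintype ℋ] {πS : 𝒮 → ℝ} {πH : ℋ → ℝ} {R : ι → ι → ℝ}
    {f : 𝒮 → N.links → ι → ℝ} {p : 𝒮 → N.links → ℝ} {e : ℋ → ι → ℝ}
    (h : X.IsESA V ℱ S H) (hV : 1 ≤ V) (hp : IsStationaryPlan N πS πH R f p e) (t : ℕ) (ω : Ω) :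
    X.lyapunov V (t + 1) ω - X.lyapunov V t ω - V * N.Utot (X.R t ω) ≤
      N.driftConst + N.weightConst - V * N.Utot R
      + ∑ n, ∑ c, X.Q t ω n c * (R n c + (N.inSum (fun l => f (S t ω) l c) n
          - N.outSum (fun l => f (S t ω) l c) n))
      + ∑ n, (X.E t ω n - N.θ V) * (e (H t ω) n - N.outSum (p (S t ω)) n) := by
  have hne : Nonempty 𝒮 := ⟨S 0 ω⟩
  have hdrift := h.feasible.lyapunov_drift (V := V) t ω
  -- The algorithm serves only positive weights, and there the differential backlog is at least the
  -- weight; so `γ` costs nothing on this side. For the plan it costs `γ` per unit of flow,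
  -- collected in `weightConst`.
  have hmu : ∑ l, X.linkWeight t ω l * N.rate (S t ω) (X.P t ω) l ≤
      ∑ l : N.links, ∑ c, (X.Q t ω l.1.1 c - X.Q t ω l.1.2 c) * X.mu t ω l c := by
    refine Finset.sum_le_sum fun l _ => ?_
    obtain ⟨c', hc', hmu, h0⟩ := h.routing t ω l
    rw [Finset.sum_eq_single c' (fun c _ hc => by rw [h0 c hc, mul_zero])
      (fun hc => absurd (Finset.mem_univ _) hc), hmu, ← hc']
    split_ifs with hw
    · refine mul_le_mul_of_nonneg_right ?_ (N.rate_nonneg _ _ (h.feasible.P_mem t ω) l)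
      refine max_le (by linarith [N.γ_nonneg]) ?_
      rcases lt_max_iff.1 hw with h1 | h1
      · linarith [N.γ_nonneg]
      · exact absurd h1 (lt_irrefl _)
    · rw [le_antisymm (not_lt.1 hw) (Run.weight_nonneg t ω l c')]
      simp
  have hf : ∑ l : N.links, ∑ c, (X.Q t ω l.1.1 c - X.Q t ω l.1.2 c) * f (S t ω) l c ≤
      ∑ l, ∑ c, X.weight t ω l c * f (S t ω) l c + N.weightConst := by
    rw [weightConst, ← Finset.sum_add_distrib]
    refine Finset.sum_le_sum fun l _ => ?_
    rw [← Finset.sum_add_distrib]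
    refine Finset.sum_le_sum fun c _ => ?_
    have h1 : X.Q t ω l.1.1 c - X.Q t ω l.1.2 c - N.γ ≤ X.weight t ω l c := le_max_left _ _
    have h2 := mul_le_mul_of_nonneg_right h1 (hp.f_nonneg (S t ω) l c)
    have h3 := mul_le_mul_of_nonneg_left (hp.f_le (S t ω) l c) N.γ_nonneg
    linarith
  have hdom := hp.dominated (S t ω) (X.weight t ω) (X.linkWeight t ω)
    (fun l => X.E t ω l.1.1 - N.θ V) (X.G V t ω (S t ω) (X.P t ω))
    (Run.weight_le_linkWeight t ω) (Run.linkWeight_nonneg t ω)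
    (fun P hP => by rw [← Run.G_eq]; exact h.G_le hV t ω hP)
  rw [Run.G_eq] at hdom
  have hadm : ∑ n, ∑ c, X.Q t ω n c * X.R t ω n c - V * N.Utot (X.R t ω) ≤
      ∑ n, ∑ c, X.Q t ω n c * R n c - V * N.Utot R := by
    simp only [Utot, Finset.mul_sum, ← Finset.sum_sub_distrib]
    refine Finset.sum_le_sum fun n _ => Finset.sum_le_sum fun c _ => ?_
    have : V * N.U n c (R n c) - X.Q t ω n c * R n c ≤
        V * N.U n c (X.R t ω n c) - X.Q t ω n c * X.R t ω n c :=
      h.admission t ω n c (hp.R_mem n c)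
    linarith
  have hharv : ∑ n, (X.E t ω n - N.θ V) * X.e t ω n ≤
      ∑ n, (X.E t ω n - N.θ V) * e (H t ω) n := by
    refine Finset.sum_le_sum fun n _ => ?_
    have he := hp.e_mem (H t ω) n
    rw [h.harvesting]
    split_ifs with hE
    · exact mul_le_mul_of_nonpos_left he.2 (by linarith)
    · rw [mul_zero]
      exact mul_nonneg (by linarith) he.1
  have e1 := sum_mul_inSum_sub_outSum (X.Q t ω) (X.mu t ω)
  have e2 := sum_mul_inSum_sub_outSum (X.Q t ω) (f (S t ω))
  have e3 := sum_mul_outSum (fun n => X.E t ω n - N.θ V) (X.P t ω)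
  have e4 := sum_mul_outSum (fun n => X.E t ω n - N.θ V) (p (S t ω))
  simp only [add_sub_assoc, mul_add, Finset.sum_add_distrib, e1] at hdrift
  simp only [mul_add, Finset.sum_add_distrib, e2]
  simp only [mul_sub (X.E t ω _ - N.θ V), Finset.sum_sub_distrib, e3] at hdrift
  simp only [mul_sub (X.E t ω _ - N.θ V), Finset.sum_sub_distrib, e4]
  linarith

end EnergyNetwork

namespace EnergyNetwork

variable {ι 𝒮 ℋ : Type*} [Fintype ι] [DecidableEq ι] (N : EnergyNetwork ι 𝒮 ℋ)

/-! ### Utilities -/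

/-- Regularity of `U` is known only on the half-line; the truncation gives a function continuous on
all of `ℝ`. -/
theorem continuous_U_max (n c : ι) : Continuous fun r : ℝ => N.U n c (max r 0) :=
  (N.U_contDiff n c).continuousOn.comp_continuous (continuous_id.max continuous_const)
    fun r => le_max_right r 0

theorem continuous_Utot_max : Continuous fun r : ι → ι → ℝ => N.Utot fun n c => max (r n c) 0 :=
  continuous_finsetSum _ fun n _ => continuous_finsetSum _ fun c _ =>
    (N.continuous_U_max n c).comp ((continuous_apply c).comp (continuous_apply n))

theorem Utot_nonneg {r : ι → ι → ℝ} (hr : ∀ n c, 0 ≤ r n c) : 0 ≤ N.Utot r :=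
  Finset.sum_nonneg fun n _ => Finset.sum_nonneg fun c _ => N.U_nonneg n c (hr n c)

variable {N} {Ω : Type*} {m : MeasurableSpace Ω} {X : N.Run Ω} {V : ℝ} {ℱ : Filtration ℕ m}
  {S : ℕ → Ω → 𝒮} {H : ℕ → Ω → ℋ}

namespace Run.IsFeasible

variable {Pr : Measure Ω} [IsProbabilityMeasure Pr]

theorem integrable_U (h : X.IsFeasible ℱ S H) (t : ℕ) (n c : ι) :
    Integrable (fun ω => N.U n c (X.R t ω n c)) Pr := by
  have e : (fun ω => N.U n c (X.R t ω n c)) = fun ω => N.U n c (max (X.R t ω n c) 0) := by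
    ext ω
    rw [max_eq_left (h.R_mem t ω n c).1]
  refine integrable_of_abs_le (D := N.U n c N.Rmax) ?_ fun ω => ?_
  · rw [e]
    exact (N.continuous_U_max n c).measurable.comp ((h.measurable_R t n c).mono (ℱ.le t) le_rfl)
  · have hR := h.R_mem t ω n c
    rw [abs_of_nonneg (N.U_nonneg n c hR.1)]
    exact N.U_mono n c hR.1 N.Rmax_nonneg hR.2

theorem integrable_Utot (h : X.IsFeasible ℱ S H) (t : ℕ) :
    Integrable (fun ω => N.Utot (X.R t ω)) Pr :=
  integrable_finsetSum _ fun n _ => integrable_finsetSum _ fun c _ => h.integrable_U t n c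

/-- Jensen's inequality for the average admitted rates. -/
theorem avg_integral_Utot_le (h : X.IsFeasible ℱ S H) {T : ℕ} (hT : 0 < T) :
    (1 / (T : ℝ)) * ∑ t ∈ Finset.range T, ∫ ω, N.Utot (X.R t ω) ∂Pr ≤ N.Utot (X.avgRate Pr T) := by
  have hT' : (0 : ℝ) < T := by exact_mod_cast hT
  have e : ∀ t, ∫ ω, N.Utot (X.R t ω) ∂Pr = ∑ n, ∑ c, ∫ ω, N.U n c (X.R t ω n c) ∂Pr := by
    intro t
    simp only [Utot]
    rw [integral_finsetSum _ fun n _ => integrable_finsetSum _ fun c _ => h.integrable_U t n c]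
    exact Finset.sum_congr rfl fun n _ => integral_finsetSum _ fun c _ => h.integrable_U t n c
  simp only [e]
  rw [Finset.sum_comm, Finset.mul_sum]
  refine Finset.sum_le_sum fun n _ => ?_
  rw [Finset.sum_comm, Finset.mul_sum]
  refine Finset.sum_le_sum fun c _ => ?_
  have hconc := (N.U_strictConcave n c).concaveOn
  have h1 : ∀ t, ∫ ω, N.U n c (X.R t ω n c) ∂Pr ≤ N.U n c (∫ ω, X.R t ω n c ∂Pr) := fun t =>
    hconc.le_map_integral (N.U_contDiff n c).continuousOn isClosed_Ici
      (ae_of_all _ fun ω => (h.R_mem t ω n c).1) (h.integrable_R t n c) (h.integrable_U t n c)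
  have h2 := hconc.le_map_sum (t := Finset.range T) (w := fun _ => 1 / (T : ℝ))
    (p := fun t => ∫ ω, X.R t ω n c ∂Pr) (fun _ _ => by positivity)
    (by rw [Finset.sum_const, Finset.card_range, nsmul_eq_mul]; field_simp)
    (fun t _ => Set.mem_Ici.2 (integral_nonneg fun ω => (h.R_mem t ω n c).1))
  simp only [smul_eq_mul, ← Finset.mul_sum] at h2
  exact (mul_le_mul_of_nonneg_left (Finset.sum_le_sum fun t _ => h1 t) (by positivity)).trans h2

end Run.IsFeasible

/-! ### Time averaging of the drift inequality -/

variable (N) in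
/-- The constant of the utility gap, in terms of bounds for the Poisson equations of the channel
and the energy chain. -/
def gapConst (CS CH : ℝ) : ℝ :=
  N.driftConst + N.weightConst + ∑ _n : ι, ∑ _c : ι, N.queueStep * (N.flowBound * CS)
    + ∑ _n : ι, (N.energyStep * (|N.hmax| * CH) + N.energyStep * (|N.Pmax| * CS))

namespace Run.IsESA

theorem abs_Q_le (h : X.IsESA V ℱ S H) (hV : 1 ≤ V) (t : ℕ) (ω : Ω) (n c : ι) :
    |X.Q t ω n c| ≤ N.β * V + N.Rmax := by
  rw [abs_of_nonneg (h.feasible.Q_nonneg t ω n c)]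
  exact h.Q_le hV t ω n c

theorem abs_E_sub_θ_le (h : X.IsESA V ℱ S H) (hV : 1 ≤ V) (t : ℕ) (ω : Ω) (n : ι) :
    |X.E t ω n - N.θ V| ≤ |N.θ V| + |N.hmax| := by
  have h1 := h.E_le hV t ω n
  have h2 := h.feasible.E_nonneg t ω n
  rw [abs_le]
  constructor <;> linarith [le_abs_self (N.θ V), le_abs_self N.hmax, abs_nonneg (N.θ V),
    abs_nonneg N.hmax]

variable {Pr : Measure Ω} [IsProbabilityMeasure Pr]

theorem integrable_lyapunov (h : X.IsESA V ℱ S H) (hV : 1 ≤ V) (t : ℕ) :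
    Integrable (X.lyapunov V t) Pr := by
  have hQ : ∀ n c, Integrable (fun ω => X.Q t ω n c ^ 2) Pr := fun n c =>
    integrable_of_abs_le (D := (N.β * V + N.Rmax) ^ 2)
      (((h.feasible.measurable_Q t n c).mono (ℱ.le t) le_rfl).pow_const 2) fun ω => by
        rw [abs_pow]
        exact pow_le_pow_left₀ (abs_nonneg _) (h.abs_Q_le hV t ω n c) 2
  have hE : ∀ n, Integrable (fun ω => (X.E t ω n - N.θ V) ^ 2) Pr := fun n =>
    integrable_of_abs_le (D := (|N.θ V| + |N.hmax|) ^ 2)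
      ((((h.feasible.measurable_E t n).mono (ℱ.le t) le_rfl).sub_const _).pow_const 2) fun ω => by
        rw [abs_pow]
        exact pow_le_pow_left₀ (abs_nonneg _) (h.abs_E_sub_θ_le hV t ω n) 2
  exact ((integrable_finsetSum _ fun n _ => integrable_finsetSum _ fun c _ => hQ n c).add
    (integrable_finsetSum _ fun n _ => hE n)).const_mul _

/-- `drift_le` is summed over time and the state-dependent terms are handled by
`sum_integral_mul_le`, with backlogs and `E - θ` as weights. Their increments give `gapConst`, free
of `V`; their sizes go into `K`, which may depend on `V` because it is divided by `T`. -/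
theorem exists_Utot_avgRate_ge [Fintype 𝒮] [DecidableEq 𝒮] [Fintype ℋ] [DecidableEq ℋ]
    {KS : Matrix 𝒮 𝒮 ℝ} {KH : Matrix ℋ ℋ ℝ} {πS : 𝒮 → ℝ} {πH : ℋ → ℝ} {FS : 𝒮 → 𝒮 → ℝ}
    {FH : ℋ → ℋ → ℝ} {R : ι → ι → ℝ} {f : 𝒮 → N.links → ι → ℝ} {p : 𝒮 → N.links → ℝ}
    {e : ℋ → ι → ℝ} (hS : IsMarkovChainFor Pr ℱ KS S) (hH : IsMarkovChainFor Pr ℱ KH H)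
    (hFS : ∀ s x, FS s x - ∑ y, KS x y * FS s y = (if x = s then 1 else 0) - πS s)
    (hFH : ∀ s x, FH s x - ∑ y, KH x y * FH s y = (if x = s then 1 else 0) - πH s)
    (h : X.IsESA V ℱ S H) (hV : 1 ≤ V) (hp : IsStationaryPlan N πS πH R f p e) :
    ∃ K, ∀ T : ℕ, 0 < T → N.Utot R - N.gapConst (poissonNorm FS) (poissonNorm FH) / V
      - K / T ≤ N.Utot (X.avgRate Pr T) := by
  have hV0 : 0 < V := by linarith
  set CS := poissonNorm FS
  set CH := poissonNorm FH
  set DQ := N.β * V + N.Rmax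
  set DE := |N.θ V| + |N.hmax|
  set g : ι → ι → 𝒮 → ℝ := fun n c s =>
    N.inSum (fun l => f s l c) n - N.outSum (fun l => f s l c) n with hg
  set b : ι → 𝒮 → ℝ := fun n s => -N.outSum (p s) n with hb
  have hgb : ∀ n c s, |g n c s| ≤ N.flowBound := fun n c s => by
    have h1 := inSum_nonneg (fun l => hp.f_nonneg s l c) n
    have h2 := inSum_le_flowBound (fun l => hp.f_le s l c) n
    have h3 := outSum_nonneg (fun l => hp.f_nonneg s l c) n
    have h4 := outSum_le_flowBound (fun l => hp.f_le s l c) n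
    rw [abs_le]
    constructor <;> simp only [hg] <;> linarith
  have hbb : ∀ n s, |b n s| ≤ |N.Pmax| := fun n s => by
    rw [abs_neg, abs_of_nonneg (outSum_nonneg (hp.p_nonneg s) n)]
    exact (hp.p_sum_le s n).trans (le_abs_self _)
  have heb : ∀ n j, |e j n| ≤ |N.hmax| := fun n j => by
    rw [abs_of_nonneg (hp.e_mem j n).1]
    exact (hp.e_mem j n).2.trans ((N.harvest_le j n).trans (le_abs_self _))
  have hQm : ∀ t n c, Measurable[ℱ t] fun ω => X.Q t ω n c := h.feasible.measurable_Q
  have hEm : ∀ t n, Measurable[ℱ t] fun ω => X.E t ω n - N.θ V := fun t n =>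
    (h.feasible.measurable_E t n).sub_const _
  have hQint := fun t n c => h.feasible.integrable_Q (Pr := Pr) t n c
  have hQg : ∀ t n c, Integrable (fun ω => X.Q t ω n c * g n c (S t ω)) Pr := fun t n c =>
    hS.integrable_mul_comp ((hQm t n c).mono (ℱ.le t) le_rfl)
      (fun ω => h.abs_Q_le hV t ω n c) t _
  have hEe : ∀ t n, Integrable (fun ω => (X.E t ω n - N.θ V) * e (H t ω) n) Pr := fun t n =>
    hH.integrable_mul_comp ((hEm t n).mono (ℱ.le t) le_rfl)
      (fun ω => h.abs_E_sub_θ_le hV t ω n) t fun j => e j n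
  have hEb : ∀ t n, Integrable (fun ω => (X.E t ω n - N.θ V) * b n (S t ω)) Pr := fun t n =>
    hS.integrable_mul_comp ((hEm t n).mono (ℱ.le t) le_rfl)
      (fun ω => h.abs_E_sub_θ_le hV t ω n) t _
  have hQterm : ∀ t n c, Integrable (fun ω => R n c * X.Q t ω n c
      + X.Q t ω n c * g n c (S t ω)) Pr := fun t n c => ((hQint t n c).const_mul _).add (hQg t n c)
  have hEterm : ∀ t n, Integrable (fun ω => (X.E t ω n - N.θ V) * e (H t ω) n
      + (X.E t ω n - N.θ V) * b n (S t ω)) Pr := fun t n => (hEe t n).add (hEb t n)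
  set c₀ := N.driftConst + N.weightConst - V * N.Utot R with hc₀
  have hslot : ∀ t, ∫ ω, X.lyapunov V (t + 1) ω ∂Pr - ∫ ω, X.lyapunov V t ω ∂Pr
      - V * ∫ ω, N.Utot (X.R t ω) ∂Pr ≤ c₀
      + ∑ n, ∑ c, (R n c * ∫ ω, X.Q t ω n c ∂Pr + ∫ ω, X.Q t ω n c * g n c (S t ω) ∂Pr)
      + ∑ n, (∫ ω, (X.E t ω n - N.θ V) * e (H t ω) n ∂Pr
          + ∫ ω, (X.E t ω n - N.θ V) * b n (S t ω) ∂Pr) := by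
    intro t
    have hL := h.integrable_lyapunov (Pr := Pr) hV
    have hLd : Integrable (fun ω => X.lyapunov V (t + 1) ω - X.lyapunov V t ω) Pr :=
      (hL (t + 1)).sub (hL t)
    have hU : Integrable (fun ω => V * N.Utot (X.R t ω)) Pr :=
      (h.feasible.integrable_Utot t).const_mul V
    have i1 : Integrable (fun ω => ∑ n, ∑ c, (R n c * X.Q t ω n c
        + X.Q t ω n c * g n c (S t ω))) Pr :=
      integrable_finsetSum _ fun n _ => integrable_finsetSum _ fun c _ => hQterm t n c
    have i2 : Integrable (fun ω => ∑ n, ((X.E t ω n - N.θ V) * e (H t ω) n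
        + (X.E t ω n - N.θ V) * b n (S t ω))) Pr :=
      integrable_finsetSum _ fun n _ => hEterm t n
    have i0 : Integrable (fun ω => c₀ + ∑ n, ∑ c, (R n c * X.Q t ω n c
        + X.Q t ω n c * g n c (S t ω))) Pr := (integrable_const c₀).add i1
    have hmono := integral_mono (hLd.sub hU) (i0.add i2) fun ω => by
      have := h.drift_le hV hp t ω
      simp only [Pi.sub_apply, Pi.add_apply]
      refine this.trans (le_of_eq ?_)
      congr 1
      · congr 1
        refine Finset.sum_congr rfl fun n _ => Finset.sum_congr rfl fun c _ => ?_
        simp only [hg]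
        ring
      · refine Finset.sum_congr rfl fun n _ => ?_
        simp only [hb]
        ring
    rw [integral_sub' hLd hU, integral_sub (hL (t + 1)) (hL t), integral_const_mul,
      integral_add' i0 i2, integral_add (integrable_const c₀) i1,
      integral_finsetSum _ fun n _ => integrable_finsetSum _ fun c _ => hQterm t n c,
      integral_finsetSum _ fun n _ => hEterm t n] at hmono
    refine hmono.trans (le_of_eq ?_)
    rw [integral_const, probReal_univ, one_smul]
    congr 1
    · congr 1
      refine Finset.sum_congr rfl fun n _ => ?_
      rw [integral_finsetSum _ fun c _ => hQterm t n c]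
      refine Finset.sum_congr rfl fun c _ => ?_
      rw [integral_add ((hQint t n c).const_mul _) (hQg t n c), integral_const_mul]
    · exact Finset.sum_congr rfl fun n _ => integral_add (hEe t n) (hEb t n)
  have hqueue : ∀ T n c, ∑ t ∈ Finset.range T,
      (R n c * ∫ ω, X.Q t ω n c ∂Pr + ∫ ω, X.Q t ω n c * g n c (S t ω) ∂Pr) ≤
      T * (N.queueStep * (N.flowBound * CS)) + 2 * (DQ * (N.flowBound * CS)) := by
    intro T n c
    have h1 := hS.sum_integral_mul_le hFS (hgb n c) (Z := fun t ω => X.Q t ω n c)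
      (fun t => hQm t n c) (fun t ω => h.abs_Q_le hV t ω n c)
      (fun t ω => h.feasible.abs_Q_sub_le t ω n c) T
    rw [Finset.sum_add_distrib, ← Finset.mul_sum]
    have h2 : (R n c + ∑ s, πS s * g n c s) * ∑ t ∈ Finset.range T, ∫ ω, X.Q t ω n c ∂Pr ≤ 0 := by
      by_cases hnc : n = c
      · subst hnc
        simp [h.feasible.Q_dest]
      · exact mul_nonpos_of_nonpos_of_nonneg (hp.flow n c hnc) (Finset.sum_nonneg fun t _ =>
          integral_nonneg fun ω => h.feasible.Q_nonneg t ω n c)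
    rw [add_mul] at h2
    linarith
  have henergy : ∀ T n, ∑ t ∈ Finset.range T, (∫ ω, (X.E t ω n - N.θ V) * e (H t ω) n ∂Pr
          + ∫ ω, (X.E t ω n - N.θ V) * b n (S t ω) ∂Pr) ≤
      T * (N.energyStep * (|N.hmax| * CH) + N.energyStep * (|N.Pmax| * CS))
        + 2 * (DE * (|N.hmax| * CH) + DE * (|N.Pmax| * CS)) := by
    intro T n
    have hstep : ∀ t ω, |X.E (t + 1) ω n - N.θ V - (X.E t ω n - N.θ V)| ≤ N.energyStep :=
      fun t ω => by
        rw [sub_sub_sub_cancel_right]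
        exact h.feasible.abs_E_sub_le t ω n
    have h1 := hH.sum_integral_mul_le hFH (heb n) (Z := fun t ω => X.E t ω n - N.θ V)
      (fun t => hEm t n) (fun t ω => h.abs_E_sub_θ_le hV t ω n) hstep T
    have h2 := hS.sum_integral_mul_le hFS (hbb n) (Z := fun t ω => X.E t ω n - N.θ V)
      (fun t => hEm t n) (fun t ω => h.abs_E_sub_θ_le hV t ω n) hstep T
    -- Mean harvest and mean power cancel, so the sums of `E - θ`, of unknown sign, drop out.
    have h3 : ∑ s, πS s * b n s = -∑ j, πH j * e j n := by
      rw [hp.energy n, ← Finset.sum_neg_distrib]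
      exact Finset.sum_congr rfl fun s _ => mul_neg _ _
    rw [h3] at h2
    rw [Finset.sum_add_distrib]
    linarith
  set K₀ := ∑ _n : ι, ∑ _c : ι, 2 * (DQ * (N.flowBound * CS))
    + ∑ _n : ι, 2 * (DE * (|N.hmax| * CH) + DE * (|N.Pmax| * CS)) with hK₀
  refine ⟨(∫ ω, X.lyapunov V 0 ω ∂Pr + K₀) / V, fun T hT => ?_⟩
  have hT' : (0 : ℝ) < T := by exact_mod_cast hT
  have hsum := Finset.sum_le_sum fun t (_ : t ∈ Finset.range T) => hslot t
  rw [Finset.sum_sub_distrib, Finset.sum_range_sub (fun t => ∫ ω, X.lyapunov V t ω ∂Pr),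
    ← Finset.mul_sum, Finset.sum_add_distrib, Finset.sum_add_distrib, Finset.sum_const,
    Finset.card_range, nsmul_eq_mul, Finset.sum_comm] at hsum
  have hq : ∑ n, ∑ t ∈ Finset.range T, ∑ c, (R n c * ∫ ω, X.Q t ω n c ∂Pr
      + ∫ ω, X.Q t ω n c * g n c (S t ω) ∂Pr) ≤
      T * ∑ _n : ι, ∑ _c : ι, N.queueStep * (N.flowBound * CS)
        + ∑ _n : ι, ∑ _c : ι, 2 * (DQ * (N.flowBound * CS)) := by
    simp only [Finset.mul_sum, ← Finset.sum_add_distrib]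
    refine Finset.sum_le_sum fun n _ => ?_
    rw [Finset.sum_comm]
    exact Finset.sum_le_sum fun c _ => by simpa using hqueue T n c
  have hen : ∑ t ∈ Finset.range T, ∑ n, (∫ ω, (X.E t ω n - N.θ V) * e (H t ω) n ∂Pr
          + ∫ ω, (X.E t ω n - N.θ V) * b n (S t ω) ∂Pr) ≤
      T * ∑ _n : ι, (N.energyStep * (|N.hmax| * CH) + N.energyStep * (|N.Pmax| * CS))
        + ∑ _n : ι, 2 * (DE * (|N.hmax| * CH) + DE * (|N.Pmax| * CS)) := by
    rw [Finset.sum_comm, Finset.mul_sum, ← Finset.sum_add_distrib]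
    exact Finset.sum_le_sum fun n _ => henergy T n
  have hLT : 0 ≤ ∫ ω, X.lyapunov V T ω ∂Pr := integral_nonneg fun ω => Run.lyapunov_nonneg T ω
  have hJ := h.feasible.avg_integral_Utot_le (Pr := Pr) hT
  rw [one_div, inv_mul_le_iff₀ hT'] at hJ
  have hgap : N.gapConst CS CH = N.driftConst + N.weightConst
      + ∑ _n : ι, ∑ _c : ι, N.queueStep * (N.flowBound * CS)
      + ∑ _n : ι, (N.energyStep * (|N.hmax| * CH) + N.energyStep * (|N.Pmax| * CS)) := rfl
  have hJV := mul_le_mul_of_nonneg_left hJ hV0.le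
  have hfinal : V * T * N.Utot R - T * N.gapConst CS CH - (∫ ω, X.lyapunov V 0 ω ∂Pr + K₀) ≤
      V * T * N.Utot (X.avgRate Pr T) := by
    have e1 : (T : ℝ) * c₀ = T * (N.driftConst + N.weightConst) - V * T * N.Utot R := by
      rw [hc₀]; ring
    rw [e1] at hsum
    have e2 : (T : ℝ) * N.gapConst CS CH = T * (N.driftConst + N.weightConst)
      + T * ∑ _n : ι, ∑ _c : ι, N.queueStep * (N.flowBound * CS)
      + T * ∑ _n : ι, (N.energyStep * (|N.hmax| * CH) + N.energyStep * (|N.Pmax| * CS)) := by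
      rw [hgap]; ring
    rw [e2]
    linarith
  refine le_of_mul_le_mul_left (le_trans (le_of_eq ?_) hfinal) (mul_pos hV0 hT')
  field_simp

end Run.IsESA

end EnergyNetwork

/-! ### Passage to the limit and the theorem -/

theorem le_liminf_of_sub_div_le {u : ℕ → ℝ} {D x K : ℝ} (hu : ∀ t, u t ≤ D)
    (h : ∀ T : ℕ, 0 < T → x - K / T ≤ u T) : x ≤ liminf u atTop := by
  have hlim : Tendsto (fun T : ℕ => x - K / T) atTop (𝓝 x) := by
    simpa using tendsto_const_nhds.sub (tendsto_const_div_atTop_nhds_zero_nat K)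
  rw [← hlim.liminf_eq]
  exact liminf_le_liminf ((eventually_gt_atTop 0).mono h) hlim.isBoundedUnder_ge
    (isCoboundedUnder_ge_of_le _ hu)

end

theorem theorem3 {ι 𝒮 ℋ : Type*} [Fintype ι] [DecidableEq ι] [Fintype 𝒮] [DecidableEq 𝒮]
    [Fintype ℋ] [DecidableEq ℋ] (N : EnergyNetwork ι 𝒮 ℋ)
    (KS : Matrix 𝒮 𝒮 ℝ) (KH : Matrix ℋ ℋ ℝ)
    (hKS : IsIrreducibleAperiodic KS) (hKH : IsIrreducibleAperiodic KH) :
    ∃ C : ℝ, ∀ V : ℝ, 1 ≤ V → ∀ (αS : 𝒮 → ℝ) (αH : ℋ → ℝ)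
      (Ω : Type*) (m : MeasurableSpace Ω) (Pr : Measure Ω) (ℱ : Filtration ℕ m)
      (S : ℕ → Ω → 𝒮) (H : ℕ → Ω → ℋ) (X : N.Run Ω),
      IsProbabilityMeasure Pr → IsMarkovPair Pr ℱ KS KH αS αH S H → X.IsESA V ℱ S H →
      ((∀ t ω n c, 0 ≤ X.Q t ω n c ∧ X.Q t ω n c ≤ N.β * V + N.Rmax) ∧
        (∀ t ω n, 0 ≤ X.E t ω n ∧ X.E t ω n ≤ N.θ V + N.hmax)) ∧
      (N.optimalUtility KS KH αS αH - C / V ≤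
          liminf (fun t : ℕ => N.Utot (X.avgRate Pr t)) atTop ∧
        (MapClusterPt (X.rbar Pr) atTop (X.avgRate Pr) →
          N.optimalUtility KS KH αS αH - C / V ≤ N.Utot (X.rbar Pr))) := by
  obtain ⟨πS, FS, hπS, hFS⟩ := exists_poisson_solution hKS.stochastic hKS.irreducible
  obtain ⟨πH, FH, hπH, hFH⟩ := exists_poisson_solution hKH.stochastic hKH.irreducible
  -- The absolute value makes the bound on the supremum nonnegative, as required because the real
  -- supremum of an empty set is `0`.
  refine ⟨|N.gapConst (poissonNorm FS) (poissonNorm FH)|, ?_⟩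
  intro V hV αS αH Ω m Pr ℱ S H X hPr hM hX
  set C := N.gapConst (poissonNorm FS) (poissonNorm FH)
  have hV0 : 0 < V := by linarith
  have hf := hX.feasible
  refine ⟨⟨fun t ω n c => ⟨hf.Q_nonneg t ω n c, hX.Q_le hV t ω n c⟩,
    fun t ω n => ⟨hf.E_nonneg t ω n, hX.E_le hV t ω n⟩⟩, ?_⟩
  have hmem := fun t n c => EnergyNetwork.Run.avgRate_mem (Pr := Pr) hf t n c
  have hub : ∀ t, N.Utot (X.avgRate Pr t) ≤ N.Utot fun _ _ => N.Rmax := fun t =>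
    EnergyNetwork.Utot_mono (fun n c => (hmem t n c).1) fun n c => (hmem t n c).2
  have hlb : ∀ t, 0 ≤ N.Utot (X.avgRate Pr t) := fun t =>
    N.Utot_nonneg fun n c => (hmem t n c).1
  have hmain : N.optimalUtility KS KH αS αH - |C| / V ≤
      liminf (fun t : ℕ => N.Utot (X.avgRate Pr t)) atTop := by
    rw [sub_le_iff_le_add]
    refine Real.sSup_le ?_ (add_nonneg (le_liminf_of_le (isCoboundedUnder_ge_of_le _ hub)
      (Eventually.of_forall hlb)) (by positivity))
    rintro u ⟨Ω', m', Pr', ℱ', S', H', Y, hPr', hM', hY, hst, hfin, rfl⟩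
    -- The plan comes from another probability space but refers only to `πS` and `πH`, so it can be
    -- compared with the run of the algorithm.
    obtain ⟨R, f, p, e, hp, hR⟩ := EnergyNetwork.exists_isStationaryPlan
      (hM'.isMarkovChainFor_left hKH.stochastic) (hM'.isMarkovChainFor_right hKS.stochastic)
      hπS hπH hFS hFH hY hst hfin
    obtain ⟨K, hK⟩ := hX.exists_Utot_avgRate_ge (hM.isMarkovChainFor_left hKH.stochastic)
      (hM.isMarkovChainFor_right hKS.stochastic) hFS hFH hV hp
    have h1 := le_liminf_of_sub_div_le hub hK
    have h2 : C / V ≤ |C| / V := div_le_div_of_nonneg_right (le_abs_self C) hV0.le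
    linarith
  refine ⟨hmain, fun hcl => ?_⟩
  by_contra hcon
  push Not at hcon
  -- With `x` strictly between, continuity gives averages near the cluster point with utility below
  -- `x` infinitely often, yet eventually all utilities exceed `x`.
  obtain ⟨x, hx1, hx2⟩ := exists_between (hcon.trans_le hmain)
  have hev : ∀ᶠ t in atTop, x < N.Utot (X.avgRate Pr t) :=
    eventually_lt_of_lt_liminf hx2 (isBoundedUnder_of ⟨0, hlb⟩)
  have hmax : ∀ {r : ι → ι → ℝ}, (∀ n c, 0 ≤ r n c) → (fun n c => max (r n c) 0) = r :=
    fun hr => funext₂ fun n c => max_eq_left (hr n c)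
  have hnhds : ∀ᶠ r in 𝓝 (X.rbar Pr), N.Utot (fun n c => max (r n c) 0) < x := by
    refine N.continuous_Utot_max.continuousAt.eventually_lt continuousAt_const ?_
    rwa [hmax (EnergyNetwork.Run.rbar_nonneg hf)]
  obtain ⟨t, ht1, ht2⟩ := ((hcl.frequently hnhds).and_eventually hev).exists
  rw [hmax fun n c => (hmem t n c).1] at ht1
  exact absurd ht1 ht2.not_gt
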